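/- **Theorem 3.3.** Let $n\ge 1$ and let $\Omega\subset\mathbb R^n$ be a bounded open set (for instance, a bounded domain with smooth boundary). Let $A:[0,\infty)\to M_n(\mathbb R)$ be continuous and bounded, with $(A(t)v,v)\ge c_0|v|^2$ for all $t\ge 0$, $v\in\mathbb R^n$ and some constant $c_0>0$. Let $m\ge 2$, with $m\le \frac{2n}{n-2}$ if $n\ge 3$. Let $g:[0,\infty)\to[0,\infty)$ be differentiable and integrable with $g(0)>0$ and $1-\int_0^\infty g(s)\,ds>0$. Let $1\le p<3/2$ and let $\xi:[0,\infty)\to[0,\infty)$ be nonincreasing and differentiable with $$g'(t)\le-\xi(t)\,g(t)^p\qquad\text{for all } t\ge 0 .$$ Let $u$ be a global weak solution of $$A(t)|u_t|^{m-2}u_t-\Delta u+\int_0^t g(t-s)\Delta u(s)\,ds=0\ \text{ in }\Omega\times(0,\infty),\qquad u=0\ \text{ on }\partial\Omega\times[0,\infty),\qquad u(0)=u_0\in H_0^1(\Omega)^n ,$$ that is, $u\in C([0,\infty);H_0^1(\Omega)^n)\cap C^1((0,\infty);L^m(\Omega)^n)$, $u(0)=u_0$, and for all $\phi\in C([0,\infty);H_0^1(\Omega)^n)$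 and all $t\ge 0$ the function $s\mapsto\int_\Omega A(s)|u_t|^{m-2}u_t(x,s)\cdot\phi(x,s)\,dx$ is integrable on $(0,t)$ and $$\int_0^t\!\!\int_\Omega\Big(\nabla u(x,s)-\int_0^s g(s-\tau)\nabla u(x,\tau)\,d\tau\Big)\cdot\nabla\phi(x,s)\,dx\,ds+\int_0^t\!\!\int_\Omega A(s)|u_t|^{m-2}u_t(x,s)\cdot\phi(x,s)\,dx\,ds=0 .$$ Let $$E(t)=\frac12\int_0^t g(t-\tau)\|\nabla u(t)-\nabla u(\tau)\|_2^2\,d\tau+\frac12\Big(1-\int_0^t g(s)\,ds\Big)\|\nabla u(t)\|_2^2 .$$ Then there are constants $\lambda_0,\lambda_1>0$ (which may depend on $u$) such that the following hold for all $t\ge 0$: $$E(t)\le\lambda_0\,e^{-\lambda_1\int_0^t\xi(s)\,ds}\quad\text{if } p=1,\qquad\qquad E(t)\le\lambda_0\Big(1+\int_0^t\xi(s)^{2p-1}\,ds\Big)^{-\frac1{2p-2}}\quad\text{if } p>1 ;$$ and if $p>1$ and $\int_0^\infty\big(1+\int_0^t\xi(s)^{2p-1}\,ds\big)^{-\frac{1}{2p-2}}dt<\infty$,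 then $$E(t)\le\lambda_0\Big(1+\int_0^t\xi(s)^{p}\,ds\Big)^{-\frac1{p-1}} .$$ The last rate is optimal for polynomially decaying $g$, in the following sense. Suppose $g(t)=a(1+t)^{-\nu}$ for $t\ge 0$, with $a>0$ and $\nu>2$. Then the exponent $\frac{\nu+1}{\nu}$ and the constant function $\nu a^{-1/\nu}$ satisfy all the assumptions made above on $p$ and $\xi$, including the integrability condition; there is a constant $C>0$ with $E(t)\le C(1+t)^{-\nu}$ for all $t\ge0$; and if $u_0\ne0$, there is a constant $c>0$ with $E(t)\ge c(1+t)^{-\nu}$ for all $t\ge 0$. -/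

import Mathlib

open MeasureTheory Set Filter Topology
open scoped ContDiff ENNReal

noncomputable section

namespace ViscoHeat

/-- `ℝⁿ` with its Euclidean norm and inner product. -/
abbrev Vec (n : ℕ) : Type := EuclideanSpace ℝ (Fin n)

/-- `n × n` Jacobian matrices with the Euclidean (Frobenius) norm and inner product. -/
abbrev Jac (n : ℕ) : Type := EuclideanSpace ℝ (Fin n × Fin n)

/-- The Hilbert space `L²(Ω; F)`, for the Lebesgue measure on `Ω`. -/
abbrev L2 {n : ℕ} (Ω : Set (Vec n)) (F : Type) [NormedAddCommGroup F] : Type :=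
  Lp F 2 (volume.restrict Ω)

/-- The classical gradient of a vector field: the entry `(i, j)` is `∂ⱼ φᵢ`. -/
def grad {n : ℕ} (φ : Vec n → Vec n) (x : Vec n) : Jac n :=
  WithLp.toLp 2 fun ij => fderiv ℝ φ x (EuclideanSpace.single ij.2 1) ij.1

theorem grad_add {n : ℕ} {φ ψ : Vec n → Vec n} (hφ : ContDiff ℝ ∞ φ) (hψ : ContDiff ℝ ∞ ψ) :
    grad (φ + ψ) = grad φ + grad ψ := by
  funext x
  ext ij
  have h1 := (hφ.differentiable (by simp)) x
  have h2 := (hψ.differentiable (by simp)) x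
  simp [grad, fderiv_add h1 h2]

theorem grad_smul {n : ℕ} {φ : Vec n → Vec n} (hφ : ContDiff ℝ ∞ φ) (c : ℝ) :
    grad (c • φ) = c • grad φ := by
  funext x
  ext ij
  have h1 := (hφ.differentiable (by simp)) x
  simp [grad, fderiv_const_smul h1 c]

/-- The pairs `(φ, ∇φ)` with `φ ∈ C_c^∞(Ω; ℝⁿ)`, as elements of `L²(Ω) × L²(Ω)`. -/
def testPairs {n : ℕ} (Ω : Set (Vec n)) : Submodule ℝ (L2 Ω (Vec n) × L2 Ω (Jac n)) where
  carrier := {w | ∃ φ : Vec n → Vec n, ContDiff ℝ ∞ φ ∧ HasCompactSupport φ ∧ tsupport φ ⊆ Ω ∧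
    w.1 =ᵐ[volume.restrict Ω] φ ∧ w.2 =ᵐ[volume.restrict Ω] grad φ}
  add_mem' := by
    rintro a b ⟨φ, hφ, cφ, sφ, aφ, gφ⟩ ⟨ψ, hψ, cψ, sψ, aψ, gψ⟩
    refine ⟨φ + ψ, hφ.add hψ, cφ.add cψ, (tsupport_add φ ψ).trans (union_subset sφ sψ), ?_, ?_⟩
    · exact (Lp.coeFn_add a.1 b.1).trans (aφ.add aψ)
    · rw [grad_add hφ hψ]
      exact (Lp.coeFn_add a.2 b.2).trans (gφ.add gψ)
  zero_mem' := by
    refine ⟨0, contDiff_const, HasCompactSupport.zero, by simp [tsupport], ?_, ?_⟩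
    · exact Lp.coeFn_zero _ _ _
    · have h : grad (0 : Vec n → Vec n) = 0 := by
        funext x
        ext ij
        simp [grad]
      rw [h]
      exact Lp.coeFn_zero _ _ _
  smul_mem' := by
    rintro c a ⟨φ, hφ, cφ, sφ, aφ, gφ⟩
    refine ⟨c • φ, hφ.const_smul c, cφ.smul_left (f := fun _ => c),
      (tsupport_smul_subset_right (fun _ => c) φ).trans sφ, ?_, ?_⟩
    · exact (Lp.coeFn_smul c a.1).trans (aφ.const_smul c)
    · rw [grad_smul hφ c]
      exact (Lp.coeFn_smul c a.2).trans (gφ.const_smul c)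

/-- `H₀¹(Ω)ⁿ`: the closure of `C_c^∞(Ω; ℝⁿ)` for the `H¹` norm. An element is stored as the
pair formed by the function and its (weak) gradient. -/
def H10 {n : ℕ} (Ω : Set (Vec n)) : Submodule ℝ (L2 Ω (Vec n) × L2 Ω (Jac n)) :=
  (testPairs Ω).topologicalClosure

/-- The function underlying an element of `H₀¹(Ω)ⁿ`. -/
def H10.fn {n : ℕ} {Ω : Set (Vec n)} (w : H10 Ω) : L2 Ω (Vec n) := w.1.1

/-- The gradient of an element of `H₀¹(Ω)ⁿ`. -/
def H10.gradient {n : ℕ} {Ω : Set (Vec n)} (w : H10 Ω) : L2 Ω (Jac n) := w.1.2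

/-- `A : ℝ⁺ → M_n(ℝ)` is continuous, bounded and uniformly positive definite. -/
structure IsCoercive {n : ℕ} (A : ℝ → Matrix (Fin n) (Fin n) ℝ) : Prop where
  continuousOn : ContinuousOn A (Ici 0)
  bounded : ∃ K : ℝ, ∀ t, 0 ≤ t → ∀ i j, |A t i j| ≤ K
  coercive : ∃ c₀ : ℝ, 0 < c₀ ∧ ∀ t, 0 ≤ t → ∀ v : Vec n,
    c₀ * ‖v‖ ^ 2 ≤ inner ℝ (Matrix.toEuclideanCLM (𝕜 := ℝ) (A t) v) v

/-- The relaxation function `g : ℝ⁺ → ℝ⁺` is differentiable, with `g(0) > 0` and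
`1 - ∫₀^∞ g > 0`. -/
structure IsRelaxation (g : ℝ → ℝ) : Prop where
  nonneg : ∀ t, 0 ≤ t → 0 ≤ g t
  differentiableOn : DifferentiableOn ℝ g (Ici 0)
  pos_zero : 0 < g 0
  integrableOn : IntegrableOn g (Ioi 0)
  integral_lt : 0 < 1 - ∫ s in Ioi (0 : ℝ), g s

/-- `1 ≤ p < 3/2`, the function `ξ : ℝ⁺ → ℝ⁺` is nonincreasing and differentiable, and
`g' ≤ -ξ gᵖ` on `ℝ⁺`. The derivative at `0` is one-sided. -/
structure DecayCondition (g ξ : ℝ → ℝ) (p : ℝ) : Prop where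
  one_le : 1 ≤ p
  lt : p < 3 / 2
  nonneg : ∀ t, 0 ≤ t → 0 ≤ ξ t
  antitoneOn : AntitoneOn ξ (Ici 0)
  differentiableOn : DifferentiableOn ℝ ξ (Ici 0)
  deriv_le : ∀ t, 0 ≤ t → derivWithin g (Ici 0) t ≤ -ξ t * g t ^ p

/-- `m ≥ 2`, and `m ≤ 2n/(n-2)` if `n ≥ 3`. -/
def ExponentCondition (n : ℕ) (m : ℝ) : Prop :=
  2 ≤ m ∧ (3 ≤ n → m ≤ 2 * (n : ℝ) / ((n : ℝ) - 2))

/-- `u` is a global weak solution of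
`A(t)|u_t|^{m-2}u_t - Δu + ∫₀ᵗ g(t-s) Δu(s) ds = 0` in `Ω × (0,∞)`, `u = 0` on `∂Ω`,
`u(0) = u₀`, with time derivative `ut`:
`u ∈ C([0,∞); H₀¹(Ω)ⁿ) ∩ C¹((0,∞); L^m(Ω)ⁿ)`, and the equation holds when tested, over every
interval `[0,t]`, with every `φ ∈ C([0,∞); H₀¹(Ω)ⁿ)`. -/
structure IsWeakSolution {n : ℕ} (Ω : Set (Vec n)) (A : ℝ → Matrix (Fin n) (Fin n) ℝ)
    (g : ℝ → ℝ) (m : ℝ) (u₀ : H10 Ω) (u : ℝ → H10 Ω) (ut : ℝ → Vec n → Vec n) : Prop where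
  initial : u 0 = u₀
  continuousOn : ContinuousOn u (Ici 0)
  memLp : ∀ t, 0 < t → MemLp (H10.fn (u t)) (ENNReal.ofReal m) (volume.restrict Ω)
  memLp_deriv : ∀ t, 0 < t → MemLp (ut t) (ENNReal.ofReal m) (volume.restrict Ω)
  /-- `ut t` is the derivative of `u` at `t` in `L^m(Ω)ⁿ`. -/
  hasDeriv : ∀ t, 0 < t → Tendsto
    (fun h : ℝ => eLpNorm (fun x => h⁻¹ • (H10.fn (u (t + h)) x - H10.fn (u t) x) - ut t x)
      (ENNReal.ofReal m) (volume.restrict Ω)) (𝓝[≠] 0) (𝓝 0)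
  continuous_deriv : ∀ t, 0 < t → Tendsto
    (fun s : ℝ => eLpNorm (fun x => ut s x - ut t x)
      (ENNReal.ofReal m) (volume.restrict Ω)) (𝓝 t) (𝓝 0)
  /-- The second time integral in the weak equation is a genuine Lebesgue integral. -/
  intervalIntegrable : ∀ φ : ℝ → H10 Ω, ContinuousOn φ (Ici 0) → ∀ t, 0 ≤ t →
    IntervalIntegrable (fun s => ∫ x in Ω, inner ℝ
      (Matrix.toEuclideanCLM (𝕜 := ℝ) (A s) (‖ut s x‖ ^ (m - 2) • ut s x)) (H10.fn (φ s) x))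
      volume 0 t
  equation : ∀ φ : ℝ → H10 Ω, ContinuousOn φ (Ici 0) → ∀ t, 0 ≤ t →
    (∫ s in (0 : ℝ)..t, inner ℝ
        (H10.gradient (u s) - ∫ τ in (0 : ℝ)..s, g (s - τ) • H10.gradient (u τ)) (H10.gradient (φ s))) +
      (∫ s in (0 : ℝ)..t, ∫ x in Ω, inner ℝ
        (Matrix.toEuclideanCLM (𝕜 := ℝ) (A s) (‖ut s x‖ ^ (m - 2) • ut s x)) (H10.fn (φ s) x)) = 0

/-- The energy
`E(t) = ½ ∫₀ᵗ g(t-τ) ‖∇u(t) - ∇u(τ)‖₂² dτ + ½ (1 - ∫₀ᵗ g) ‖∇u(t)‖₂²`. -/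
def energy {n : ℕ} {Ω : Set (Vec n)} (g : ℝ → ℝ) (u : ℝ → H10 Ω) (t : ℝ) : ℝ :=
  1 / 2 * (∫ τ in (0 : ℝ)..t, g (t - τ) * ‖H10.gradient (u t) - H10.gradient (u τ)‖ ^ 2) +
    1 / 2 * (1 - ∫ s in (0 : ℝ)..t, g s) * ‖H10.gradient (u t)‖ ^ 2

/-- The function `t ↦ (1 + ∫₀ᵗ ξ^{2p-1})^{-1/(2p-2)}` is integrable on `(0,∞)`. -/
def IntegrableRate (ξ : ℝ → ℝ) (p : ℝ) : Prop :=
  IntegrableOn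
    (fun t => (1 + ∫ s in (0 : ℝ)..t, ξ s ^ (2 * p - 1)) ^ (-1 / (2 * p - 2))) (Ioi 0)

end ViscoHeat

end

/-! Beyond the weak formulation, the argument concerns only the curve w = ∇u in the Hilbert space
L². Put l = 1 - ∫₀^∞ g, let P be c₀ times the m-th power of the L^m norm of u_t, and mem_γ(t) = ∫₀ᵗ
γ(t-τ)‖w(t)-w(τ)‖² dτ. Two facts are extracted from the equation.

Energy inequality (`IsWeakSolution.isDissipative`). Formally, testing with u_t gives E' ≤ -X with X
= P - ½ mem_{g'} ≥ 0. Since u_t need not lie in H₀¹, the test function is the symmetric difference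
u(s+h) - u(s-h), divided by 2h at the end. Summation by parts is exact for the elliptic term, and g
* w has a continuous derivative although w has none; on the damping term the difference quotients
converge to u_t in L^m, uniformly on compact time intervals. The result is an inequality integrated
over [s,t] with s > 0.

Stabilization (`IsWeakSolution.exists_stabilization`). Testing with u at almost every time and using
Sobolev–Poincaré, Young and l > 0 gives E ≤ C₀(P + mem_g).

It remains to control ξ mem_g by X. If ξg ≤ λb + λ^{1-q}(-g') for every λ > 0, and mem_b is bounded,
then since ξ is nonincreasing ξ mem_g is at most λ mem_b + λ^{1-q}(-mem_{g'}). Taking λ proportional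
to ξE absorbs the first term and leaves (ξE)^q ≤ CX (`IsDissipative.exists_rpow_le`), so E' ≤ -cξ^q
E^q in integrated form, and comparison with the explicit solution of this ODE gives the rate. The
three estimates are three choices of b and q: for p = 1, b = 0 and q = 1; for p > 1, b = ξ√g and q =
2p-1, where mem_b is bounded because ξ√g ≤ -g' g^{1/2-p} where g > 0, and this is the derivative of
a bounded function when p < 3/2; if the rate so obtained is integrable, then ∫E < ∞, hence already
the constant kernel b = ξ(0) has bounded mem_b, and q = p is allowed.

For g = a(1+t)^{-ν} the condition on g' is an equality with p = 1 + 1/ν, and the last rate becomes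
(1+t)^{-ν}. No faster decay is possible: either w(t) stays away from 0, or it is far from w(τ) for τ
near 0, and then the memory term alone is at least of order g(t). -/

open scoped NNReal

namespace ViscoHeat

/-! ### Causal convolutions with integrable kernels -/

section Convolution

variable {F : Type*} [NormedAddCommGroup F] [NormedSpace ℝ F]

/-- The causal convolution `∫₀ᵗ γ(t-τ) f(τ) dτ`. -/
noncomputable def conv (γ : ℝ → ℝ) (f : ℝ → F) (t : ℝ) : F :=
  ∫ τ in (0 : ℝ)..t, γ (t - τ) • f τ

theorem intervalIntegrable_of_Ioi {G : Type*} [NormedAddCommGroup G] {γ : ℝ → G} (hγ : IntegrableOn γ (Ioi 0)) {a b : ℝ}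
    (ha : 0 ≤ a) (hb : 0 ≤ b) : IntervalIntegrable γ volume a b := by
  rw [intervalIntegrable_iff]
  exact hγ.mono_set fun x hx => lt_of_le_of_lt (le_min ha hb) hx.1

theorem intervalIntegrable_comp_sub {γ : ℝ → ℝ} (hγ : IntegrableOn γ (Ioi 0)) {t : ℝ}
    (ht : 0 ≤ t) : IntervalIntegrable (fun τ => γ (t - τ)) volume 0 t := by
  have h := (intervalIntegrable_of_Ioi hγ le_rfl ht).comp_sub_left t
  simpa using h.symm

theorem conv_intervalIntegrable {γ : ℝ → ℝ} (hγ : IntegrableOn γ (Ioi 0)) {f : ℝ → F}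
    (hf : Continuous f) {t : ℝ} (ht : 0 ≤ t) :
    IntervalIntegrable (fun τ => γ (t - τ) • f τ) volume 0 t :=
  (intervalIntegrable_comp_sub hγ ht).smul_continuousOn hf.continuousOn

theorem conv_eq_comp_sub (γ : ℝ → ℝ) (f : ℝ → F) (t : ℝ) :
    conv γ f t = ∫ σ in (0 : ℝ)..t, γ σ • f (t - σ) := by
  have h := intervalIntegral.integral_comp_sub_left (a := 0) (b := t)
    (fun σ => γ σ • f (t - σ)) t
  simpa [conv] using h

/-- The kernel is only integrable, as g' will be, so the time variable is moved into the continuous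
factor f. Constancy of f on negative times makes the translated function available on a fixed
interval. -/
theorem conv_continuousOn [CompleteSpace F] {γ : ℝ → ℝ} (hγ : IntegrableOn γ (Ioi 0)) {f : ℝ → F}
    (hf : Continuous f) (hneg : ∀ s ≤ 0, f s = f 0) : ContinuousOn (conv γ f) (Ici 0) := by
  intro t₀ ht₀
  have ht₀' : (0 : ℝ) ≤ t₀ := ht₀
  set T := t₀ + 1 with hT
  have hT0 : 0 ≤ T := by linarith
  have hγT := intervalIntegrable_of_Ioi hγ le_rfl hT0
  -- Integrating up to the fixed T adds the piece σ > t, where f(t-σ) = f(0); the last term removes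
  -- it.
  have key : ∀ t ∈ Icc 0 T, conv γ f t =
      (∫ σ in (0 : ℝ)..T, γ σ • f (t - σ)) -
        ((∫ σ in (0 : ℝ)..T, γ σ) - ∫ σ in (0 : ℝ)..t, γ σ) • f 0 := by
    intro t ht
    have i1 : IntervalIntegrable (fun σ => γ σ • f (t - σ)) volume 0 t :=
      (intervalIntegrable_of_Ioi hγ le_rfl ht.1).smul_continuousOn
        (hf.comp (continuous_const.sub continuous_id)).continuousOn
    have i2 : IntervalIntegrable (fun σ => γ σ • f (t - σ)) volume t T :=
      (intervalIntegrable_of_Ioi hγ ht.1 hT0).smul_continuousOn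
        (hf.comp (continuous_const.sub continuous_id)).continuousOn
    have e2 : ∫ σ in t..T, γ σ • f (t - σ) = (∫ σ in t..T, γ σ) • f 0 := by
      rw [← intervalIntegral.integral_smul_const]
      refine intervalIntegral.integral_congr fun σ hσ => ?_
      rw [uIcc_of_le ht.2] at hσ
      rw [hneg (t - σ) (by linarith [hσ.1])]
    rw [conv_eq_comp_sub, ← intervalIntegral.integral_add_adjacent_intervals i1 i2, e2,
      ← intervalIntegral.integral_interval_sub_left hγT (intervalIntegrable_of_Ioi hγ le_rfl ht.1)]
    abel
  have hb : ∃ M, ∀ s ∈ Icc (-T) T, ‖f s‖ ≤ M := isCompact_Icc.exists_bound_of_continuousOn hf.continuousOn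
  obtain ⟨M, hM⟩ := hb
  have hne : ∀ s ≤ T, ‖f s‖ ≤ M := by
    intro s hs
    rcases le_total s 0 with h | h
    · rw [hneg s h]; exact hM 0 ⟨by linarith, hT0⟩
    · exact hM s ⟨by linarith, hs⟩
  have c1 : ContinuousAt (fun t => ∫ σ in (0 : ℝ)..T, γ σ • f (t - σ)) t₀ := by
    refine intervalIntegral.continuousAt_of_dominated_interval
      (bound := fun σ => ‖γ σ‖ * M) ?_ ?_ (hγT.norm.mul_const M) ?_
    · refine Eventually.of_forall fun t => ?_
      exact (hγT.smul_continuousOn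
        (hf.comp (continuous_const.sub continuous_id)).continuousOn).def'.aestronglyMeasurable
    · filter_upwards [Iio_mem_nhds (show t₀ < T by linarith)] with t ht
      refine Eventually.of_forall fun σ hσ => ?_
      rw [uIoc_of_le hT0] at hσ
      rw [norm_smul]
      exact mul_le_mul_of_nonneg_left (hne _ (by linarith [hσ.1, mem_Iio.1 ht])) (norm_nonneg _)
    · refine Eventually.of_forall fun σ _ => ?_
      exact (continuous_const.smul (hf.comp (continuous_id.sub continuous_const))).continuousAt
  have c2 : ContinuousWithinAt (fun t => ∫ σ in (0 : ℝ)..t, γ σ) (Icc 0 T) t₀ := by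
    have h := intervalIntegral.continuousOn_primitive_interval' (b₁ := 0) (b₂ := T) (a := 0) hγT
      (by simp)
    rw [uIcc_of_le hT0] at h
    exact h t₀ ⟨ht₀', by linarith⟩
  have c3 : ContinuousWithinAt (conv γ f) (Icc 0 T) t₀ :=
    ((c1.continuousWithinAt).sub ((continuousWithinAt_const.sub c2).smul
      continuousWithinAt_const)).congr (fun t ht => key t ht) (key t₀ ⟨ht₀', by linarith⟩)
  refine c3.mono_of_mem_nhdsWithin ?_
  exact mem_nhdsWithin.2 ⟨Iio T, isOpen_Iio, by simp [hT], fun x hx => ⟨hx.2, le_of_lt hx.1⟩⟩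

/-- Fubini on the triangle 0 < τ < r < t. Cutting γ and f off by indicators turns the triangle into
a product, where integrability is the standard one of a convolution integrand. -/
theorem integral_conv [CompleteSpace F] {γ : ℝ → ℝ} (hγ : IntegrableOn γ (Ioi 0)) {f : ℝ → F}
    (hf : Continuous f) {t : ℝ} (ht : 0 ≤ t) :
    ∫ r in (0 : ℝ)..t, conv γ f r =
      ∫ τ in (0 : ℝ)..t, (∫ σ in (0 : ℝ)..(t - τ), γ σ) • f τ := by
  set γ₀ : ℝ → ℝ := (Ioi 0).indicator γ with hγ₀
  set f₀ : ℝ → F := (Ioc 0 t).indicator f with hf₀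
  have i1 : Integrable γ₀ := hγ.integrable_indicator measurableSet_Ioi
  have i2 : Integrable f₀ :=
    (hf.continuousOn.integrableOn_Icc.mono_set Ioc_subset_Icc_self).integrable_indicator
      measurableSet_Ioc
  have hint : Integrable (fun z : ℝ × ℝ => γ₀ (z.1 - z.2) • f₀ z.2)
      ((volume.restrict (Ioc 0 t)).prod volume) := by
    have h := i2.convolution_integrand (ContinuousLinearMap.lsmul ℝ ℝ (E := F)).flip i1
    refine Integrable.mono_measure h ?_
    exact Measure.prod_mono Measure.restrict_le_self le_rfl
  have hswap := integral_integral_swap (f := fun r τ => γ₀ (r - τ) • f₀ τ) hint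
  rw [intervalIntegral.integral_of_le ht, intervalIntegral.integral_of_le ht]
  have hl : ∫ r in Ioc 0 t, conv γ f r = ∫ r in Ioc 0 t, ∫ τ, γ₀ (r - τ) • f₀ τ := by
    refine setIntegral_congr_fun measurableSet_Ioc fun r hr => ?_
    rw [conv, intervalIntegral.integral_of_le hr.1.le, integral_Ioc_eq_integral_Ioo,
      ← integral_indicator measurableSet_Ioo]
    refine integral_congr_ae (Eventually.of_forall fun τ => ?_)
    simp only [indicator, hγ₀, hf₀, mem_Ioo, mem_Ioi, mem_Ioc, sub_pos]
    by_cases h1 : 0 < τ <;> by_cases h2 : τ < r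
    · simp [h1, h2, (h2.le.trans hr.2)]
    · simp [h1, h2]
    · simp [h1, h2]
    · simp [h1, h2]
  have hr : ∫ τ, ∫ r in Ioc 0 t, γ₀ (r - τ) • f₀ τ =
      ∫ τ in Ioc 0 t, (∫ σ in (0 : ℝ)..(t - τ), γ σ) • f τ := by
    rw [← integral_indicator measurableSet_Ioc]
    refine integral_congr_ae (Eventually.of_forall fun τ => ?_)
    simp only
    rw [integral_smul_const]
    by_cases hτ : τ ∈ Ioc 0 t
    · rw [indicator_of_mem hτ, hf₀, indicator_of_mem hτ]
      congr 1
      rw [← intervalIntegral.integral_of_le ht, intervalIntegral.integral_comp_sub_right γ₀ τ]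
      rw [intervalIntegral.integral_of_le (by linarith), intervalIntegral.integral_of_le
        (by linarith [hτ.2]), hγ₀, setIntegral_indicator measurableSet_Ioi]
      congr 2
      ext x
      simp only [mem_inter_iff, mem_Ioc, mem_Ioi]
      constructor
      · rintro ⟨⟨_, h⟩, h'⟩; exact ⟨h', h⟩
      · rintro ⟨h', h⟩; exact ⟨⟨by linarith [hτ.1], h⟩, h'⟩
    · rw [indicator_of_notMem hτ, hf₀, indicator_of_notMem hτ, smul_zero]
  rw [hl, hswap, hr]

/-- The integrated form of (g * f)' = g(0)f + g' * f, with γ in the role of g'. It makes g * f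
differentiable with no regularity of f beyond continuity. -/
theorem conv_eq_integral [CompleteSpace F] {g γ : ℝ → ℝ} (hγ : IntegrableOn γ (Ioi 0))
    (hg : ∀ t, 0 ≤ t → ∫ σ in (0 : ℝ)..t, γ σ = g t - g 0) {f : ℝ → F}
    (hf : Continuous f) (hneg : ∀ s ≤ 0, f s = f 0) {t : ℝ} (ht : 0 ≤ t) :
    conv g f t = ∫ r in (0 : ℝ)..t, (g 0 • f r + conv γ f r) := by
  have i1 : IntervalIntegrable (fun r => g 0 • f r) volume 0 t :=
    (hf.const_smul (g 0)).intervalIntegrable _ _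
  have i2 : IntervalIntegrable (conv γ f) volume 0 t :=
    ((conv_continuousOn hγ hf hneg).mono
      (by rw [uIcc_of_le ht]; exact Icc_subset_Ici_self)).intervalIntegrable
  have i2' : IntervalIntegrable (fun τ => (∫ σ in (0 : ℝ)..(t - τ), γ σ) • f τ) volume 0 t := by
    have hγT := intervalIntegrable_of_Ioi hγ le_rfl ht
    have h := intervalIntegral.continuousOn_primitive_interval' (b₁ := 0) (b₂ := t) (a := 0) hγT
      (by simp)
    refine ContinuousOn.intervalIntegrable (ContinuousOn.smul ?_ hf.continuousOn)
    refine h.comp (continuous_const.sub continuous_id).continuousOn fun x hx => ?_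
    rw [uIcc_of_le ht] at hx ⊢
    exact ⟨by simpa using hx.2, by simpa using hx.1⟩
  rw [intervalIntegral.integral_add i1 i2, integral_conv hγ hf ht,
    ← intervalIntegral.integral_add i1 i2', conv]
  refine intervalIntegral.integral_congr fun τ hτ => ?_
  rw [uIcc_of_le ht] at hτ
  rw [hg (t - τ) (by linarith [hτ.2]), ← add_smul]
  congr 1
  ring

end Convolution

/-! ### Consequences of the decay condition for the kernel -/

section Relaxation

variable {g ξ : ℝ → ℝ} {p : ℝ}

theorem IsRelaxation.hasDerivAt (hg : IsRelaxation g) {t : ℝ} (ht : 0 < t) :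
    HasDerivAt g (deriv g t) t :=
  ((hg.differentiableOn t ht.le).differentiableAt (Ici_mem_nhds ht)).hasDerivAt

theorem IsRelaxation.continuousOn (hg : IsRelaxation g) : ContinuousOn g (Ici 0) :=
  hg.differentiableOn.continuousOn

theorem DecayCondition.deriv_le_of_pos (hp : DecayCondition g ξ p) {t : ℝ} (ht : 0 < t) :
    deriv g t ≤ -ξ t * g t ^ p := by
  have h := hp.deriv_le t ht.le
  rwa [derivWithin_of_mem_nhds (Ici_mem_nhds ht)] at h

theorem DecayCondition.deriv_nonpos (hg : IsRelaxation g) (hp : DecayCondition g ξ p) {t : ℝ}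
    (ht : 0 < t) : deriv g t ≤ 0 := by
  have h1 := hp.deriv_le_of_pos ht
  have h2 := mul_nonneg (hp.nonneg t ht.le) (Real.rpow_nonneg (hg.nonneg t ht.le) p)
  linarith

theorem DecayCondition.antitoneOn_kernel (hg : IsRelaxation g) (hp : DecayCondition g ξ p) :
    AntitoneOn g (Ici 0) := by
  refine antitoneOn_of_deriv_nonpos (convex_Ici 0) hg.continuousOn
    (hg.differentiableOn.mono interior_subset) fun x hx => ?_
  rw [interior_Ici] at hx
  exact hp.deriv_nonpos hg hx

/-- A nonpositive derivative is integrable as soon as the function has a limit, and g is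
nonincreasing and bounded below by 0. -/
theorem DecayCondition.integrableOn_deriv (hg : IsRelaxation g) (hp : DecayCondition g ξ p) :
    IntegrableOn (deriv g) (Ioi 0) := by
  have hanti : Antitone fun t => g (max t 0) := fun a b hab =>
    hp.antitoneOn_kernel hg (le_max_right a 0) (le_max_right b 0) (max_le_max_right 0 hab)
  have hbdd : BddBelow (range fun t => g (max t 0)) :=
    ⟨0, by rintro _ ⟨t, rfl⟩; exact hg.nonneg _ (le_max_right t 0)⟩
  have hlim := tendsto_atTop_ciInf hanti hbdd
  refine integrableOn_Ioi_deriv_of_nonpos (hg.continuousOn 0 self_mem_Ici)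
    (fun x hx => hg.hasDerivAt hx) (fun x hx => hp.deriv_nonpos hg hx) (hlim.congr' ?_)
  filter_upwards [eventually_ge_atTop 0] with t ht
  rw [max_eq_left ht]

theorem DecayCondition.integral_deriv (hg : IsRelaxation g) (hp : DecayCondition g ξ p) {t : ℝ}
    (ht : 0 ≤ t) : ∫ σ in (0 : ℝ)..t, deriv g σ = g t - g 0 :=
  intervalIntegral.integral_eq_sub_of_hasDerivAt_of_le ht
    (hg.continuousOn.mono Icc_subset_Ici_self) (fun _ hx => hg.hasDerivAt hx.1)
    (intervalIntegrable_of_Ioi (hp.integrableOn_deriv hg) le_rfl ht)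

theorem IsRelaxation.integral_le (hg : IsRelaxation g) {t : ℝ} (ht : 0 ≤ t) :
    ∫ s in (0 : ℝ)..t, g s ≤ ∫ s in Ioi (0 : ℝ), g s := by
  rw [intervalIntegral.integral_of_le ht]
  refine setIntegral_mono_set hg.integrableOn ?_ (ae_of_all _ fun x hx => hx.1)
  exact (ae_restrict_mem measurableSet_Ioi).mono fun x hx => hg.nonneg x (le_of_lt hx)

theorem IsRelaxation.integral_nonneg (hg : IsRelaxation g) {t : ℝ} (ht : 0 ≤ t) :
    0 ≤ ∫ s in (0 : ℝ)..t, g s :=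
  intervalIntegral.integral_nonneg ht fun x hx => hg.nonneg x hx.1

/-- Where g > 0, ξ g^{1/2} = ξ g^p g^{1/2-p} ≤ -g' g^{r-1} = -(g^r/r)' with r = 3/2 - p. This is the
place where p < 3/2 is needed: r > 0 keeps the primitive bounded. -/
theorem DecayCondition.exists_integral_sqrt_le (hg : IsRelaxation g) (hp : DecayCondition g ξ p) :
    ∃ M, 0 ≤ M ∧ ∀ t, 0 ≤ t → ∫ s in (0 : ℝ)..t, ξ s * g s ^ (1 / 2 : ℝ) ≤ M := by
  set r := 3 / 2 - p with hr
  have hr0 : 0 < r := by linarith [hp.lt]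
  have hg0 : 0 < g 0 + 1 := by linarith [hg.pos_zero]
  refine ⟨(g 0 + 1) ^ r / r, by positivity, fun t ht => ?_⟩
  have hsub : uIcc 0 t ⊆ Ici 0 := by rw [uIcc_of_le ht]; exact Icc_subset_Ici_self
  have hξc := hp.differentiableOn.continuousOn
  -- As r - 1 < 0 and g may vanish, the singular factor is regularized to (g + ε)^{r-1}. The bound
  -- below is uniform in ε ≤ 1, and ε = 1/(n+1) tends to 0 by dominated convergence.
  have hcont : ∀ ε > 0, ContinuousOn (fun s => ξ s * (g s ^ p * (g s + ε) ^ (r - 1))) (Ici 0) := by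
    intro ε hε
    refine hξc.mul ((hg.continuousOn.rpow_const fun x hx => Or.inr (by linarith [hp.one_le])).mul
      ((hg.continuousOn.add continuousOn_const).rpow_const fun x hx => Or.inl ?_))
    exact (add_pos_of_nonneg_of_pos (hg.nonneg x hx) hε).ne'
  have hle : ∀ ε, 0 < ε → ε ≤ 1 →
      ∫ s in (0 : ℝ)..t, ξ s * (g s ^ p * (g s + ε) ^ (r - 1)) ≤ (g 0 + 1) ^ r / r := by
    intro ε hε hε1
    have hpos : ∀ x, 0 ≤ x → 0 < g x + ε := fun x hx => by linarith [hg.nonneg x hx]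
    have h := intervalIntegral.integral_le_sub_of_hasDeriv_right_of_le
      (g := fun s => -((g s + ε) ^ r / r)) (g' := fun s => -(deriv g s * (g s + ε) ^ (r - 1)))
      (φ := fun s => ξ s * (g s ^ p * (g s + ε) ^ (r - 1))) ht ?_ ?_ ?_ ?_
    · refine h.trans ?_
      have h1 : (g 0 + ε) ^ r ≤ (g 0 + 1) ^ r :=
        Real.rpow_le_rpow (hpos 0 le_rfl).le (by linarith) hr0.le
      have h2 : 0 ≤ (g t + ε) ^ r / r := div_nonneg (Real.rpow_nonneg (hpos t ht).le _) hr0.le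
      have h3 := div_le_div_of_nonneg_right h1 hr0.le
      linarith
    · exact ((((hg.continuousOn.mono Icc_subset_Ici_self).add continuousOn_const).rpow_const
        fun x hx => Or.inr hr0.le).div_const r).neg
    · intro x hx
      have hd := (((hg.hasDerivAt hx.1).add_const ε).rpow_const (p := r)
        (Or.inl (hpos x hx.1.le).ne')).div_const r |>.neg
      refine (hd.congr_deriv ?_).hasDerivWithinAt
      field_simp
    · exact ((hcont ε hε).mono Icc_subset_Ici_self).integrableOn_Icc
    · intro x hx
      have h1 := hp.deriv_le_of_pos hx.1
      have h2 : 0 ≤ (g x + ε) ^ (r - 1) := Real.rpow_nonneg (hpos x hx.1.le).le _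
      nlinarith [mul_le_mul_of_nonneg_right h1 h2]
  have hlim : Tendsto (fun n : ℕ => ∫ s in (0 : ℝ)..t,
      ξ s * (g s ^ p * (g s + 1 / ((n : ℝ) + 1)) ^ (r - 1))) atTop
      (𝓝 (∫ s in (0 : ℝ)..t, ξ s * g s ^ (1 / 2 : ℝ))) := by
    refine intervalIntegral.tendsto_integral_filter_of_dominated_convergence
      (fun s => ξ s * g s ^ (1 / 2 : ℝ)) ?_ ?_ ?_ ?_
    · refine Eventually.of_forall fun n => ?_
      exact ((hcont (1 / ((n : ℝ) + 1)) (by positivity)).mono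
        hsub).intervalIntegrable.def'.aestronglyMeasurable
    · refine Eventually.of_forall fun n => Eventually.of_forall fun s hs => ?_
      rw [uIoc_of_le ht] at hs
      have hs0 := hg.nonneg s hs.1.le
      have hn : (0 : ℝ) < 1 / ((n : ℝ) + 1) := by positivity
      rw [Real.norm_of_nonneg (mul_nonneg (hp.nonneg s hs.1.le) (by positivity))]
      refine mul_le_mul_of_nonneg_left ?_ (hp.nonneg s hs.1.le)
      rcases hs0.eq_or_lt with h | h
      · rw [← h, Real.zero_rpow (by linarith [hp.one_le]), zero_mul]
        positivity
      · calc g s ^ p * (g s + 1 / ((n : ℝ) + 1)) ^ (r - 1) ≤ g s ^ p * g s ^ (r - 1) := by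
              refine mul_le_mul_of_nonneg_left ?_ (by positivity)
              exact Real.rpow_le_rpow_of_nonpos h (by linarith) (by linarith [hp.one_le])
          _ = g s ^ (1 / 2 : ℝ) := by rw [← Real.rpow_add h]; congr 1; rw [hr]; ring
    · exact ((hξc.mul (hg.continuousOn.rpow_const fun x hx => Or.inr (by norm_num))).mono
        hsub).intervalIntegrable
    · refine Eventually.of_forall fun s hs => ?_
      rw [uIoc_of_le ht] at hs
      refine Tendsto.const_mul _ ?_
      rcases (hg.nonneg s hs.1.le).eq_or_lt with h | h
      · rw [← h, Real.zero_rpow (by linarith [hp.one_le]), Real.zero_rpow (by norm_num)]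
        simp
      · have h1 : Tendsto (fun n : ℕ => g s + 1 / ((n : ℝ) + 1)) atTop (𝓝 (g s + 0)) :=
          tendsto_const_nhds.add tendsto_one_div_add_atTop_nhds_zero_nat
        rw [add_zero] at h1
        have h2 := (h1.rpow_const (p := r - 1) (Or.inl h.ne')).const_mul (g s ^ p)
        rw [← Real.rpow_add h, show p + (r - 1) = 1 / 2 by rw [hr]; ring] at h2
        exact h2
  refine le_of_tendsto' hlim fun n => hle _ (by positivity) ?_
  rw [div_le_one (by positivity)]
  linarith [n.cast_nonneg (α := ℝ)]

end Relaxation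

/-! ### Symmetric differences as a substitute for the time derivative -/

section SymmetricDifference

variable {H : Type*} [NormedAddCommGroup H] [InnerProductSpace ℝ H]

theorem continuous_average {G : Type*} [NormedAddCommGroup G] [NormedSpace ℝ G] {c : ℝ → ℝ → G}
    (hc : Continuous (Function.uncurry c)) : Continuous fun h => ∫ σ in (0 : ℝ)..1, c h σ :=
  intervalIntegral.continuous_parametric_intervalIntegral_of_continuous' hc 0 1

theorem integral_eq_mul_average {G : Type*} [NormedAddCommGroup G] [NormedSpace ℝ G]
    (c : ℝ → G) (t h : ℝ) :
    ∫ s in t..(t + h), c s = h • ∫ σ in (0 : ℝ)..1, c (t + h * σ) := by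
  rw [intervalIntegral.smul_integral_comp_add_mul]
  simp

/-- Summation by parts for symmetric differences. -/
theorem integral_inner_symmDiff {f w : ℝ → H} (hf : Continuous f) (hw : Continuous w)
    (t₁ t₂ h : ℝ) :
    ∫ s in t₁..t₂, inner ℝ (f s) (w (s + h) - w (s - h)) =
      h * ((∫ σ in (0 : ℝ)..1, inner ℝ (f (t₂ + h * σ - h)) (w (t₂ + h * σ))) -
          (∫ σ in (0 : ℝ)..1, inner ℝ (f (t₁ + h * σ - h)) (w (t₁ + h * σ)))) +
        h * ((∫ σ in (0 : ℝ)..1, inner ℝ (f (t₂ + -h * σ - -h)) (w (t₂ + -h * σ))) -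
          (∫ σ in (0 : ℝ)..1, inner ℝ (f (t₁ + -h * σ - -h)) (w (t₁ + -h * σ)))) -
        ∫ s in t₁..t₂, inner ℝ (f (s + h) - f (s - h)) (w s) := by
  have c : ∀ a b : ℝ, Continuous fun s => inner ℝ (f (s + a)) (w (s + b)) := fun a b =>
    (hf.comp (continuous_id.add continuous_const)).inner
      (hw.comp (continuous_id.add continuous_const))
  have key : ∀ r : ℝ, ∫ s in t₁..t₂, inner ℝ (f s) (w (s + r)) =
      r * ((∫ σ in (0 : ℝ)..1, inner ℝ (f (t₂ + r * σ - r)) (w (t₂ + r * σ))) -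
        (∫ σ in (0 : ℝ)..1, inner ℝ (f (t₁ + r * σ - r)) (w (t₁ + r * σ)))) +
      ∫ s in t₁..t₂, inner ℝ (f (s - r)) (w s) := by
    intro r
    have hc : Continuous fun s => inner ℝ (f (s - r)) (w s) := by
      simpa [sub_eq_add_neg] using c (-r) 0
    have i : ∀ a b, IntervalIntegrable (fun s => inner ℝ (f (s - r)) (w s)) volume a b :=
      fun a b => hc.intervalIntegrable a b
    have e1 : ∫ s in t₁..t₂, inner ℝ (f s) (w (s + r)) =
        ∫ s in (t₁ + r)..(t₂ + r), inner ℝ (f (s - r)) (w s) := by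
      rw [← intervalIntegral.integral_comp_add_right]
      simp
    have e2 := integral_eq_mul_average (fun s => inner ℝ (f (s - r)) (w s)) t₁ r
    have e3 := integral_eq_mul_average (fun s => inner ℝ (f (s - r)) (w s)) t₂ r
    have e4 := intervalIntegral.integral_add_adjacent_intervals (i t₁ (t₁ + r)) (i (t₁ + r) (t₂ + r))
    have e5 := intervalIntegral.integral_add_adjacent_intervals (i t₁ t₂) (i t₂ (t₂ + r))
    simp only [smul_eq_mul] at e2 e3
    rw [e1]
    linarith
  have k1 := key h
  have k2 := key (-h)
  have i1 : IntervalIntegrable (fun s => inner ℝ (f s) (w (s + h))) volume t₁ t₂ := by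
    simpa using (c 0 h).intervalIntegrable t₁ t₂
  have i2 : IntervalIntegrable (fun s => inner ℝ (f s) (w (s - h))) volume t₁ t₂ := by
    simpa [sub_eq_add_neg] using (c 0 (-h)).intervalIntegrable t₁ t₂
  have i3 : IntervalIntegrable (fun s => inner ℝ (f (s + h)) (w s)) volume t₁ t₂ := by
    simpa using (c h 0).intervalIntegrable t₁ t₂
  have i4 : IntervalIntegrable (fun s => inner ℝ (f (s - h)) (w s)) volume t₁ t₂ := by
    simpa [sub_eq_add_neg] using (c (-h) 0).intervalIntegrable t₁ t₂
  simp only [inner_sub_left, inner_sub_right]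
  rw [intervalIntegral.integral_sub i1 i2, intervalIntegral.integral_sub i3 i4, k1]
  simp only [← sub_eq_add_neg, sub_neg_eq_add] at k2 ⊢
  rw [k2]
  ring

theorem tendsto_boundary {f w : ℝ → H} (hf : Continuous f) (hw : Continuous w) (t₁ t₂ : ℝ) :
    Tendsto (fun h : ℝ =>
      ((∫ σ in (0 : ℝ)..1, inner ℝ (f (t₂ + h * σ - h)) (w (t₂ + h * σ))) -
          (∫ σ in (0 : ℝ)..1, inner ℝ (f (t₁ + h * σ - h)) (w (t₁ + h * σ)))) +
        ((∫ σ in (0 : ℝ)..1, inner ℝ (f (t₂ + -h * σ - -h)) (w (t₂ + -h * σ))) -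
          (∫ σ in (0 : ℝ)..1, inner ℝ (f (t₁ + -h * σ - -h)) (w (t₁ + -h * σ)))))
      (𝓝 0) (𝓝 (2 * (inner ℝ (f t₂) (w t₂) - inner ℝ (f t₁) (w t₁)))) := by
  have hM : ∀ t : ℝ, Continuous fun h : ℝ =>
      ∫ σ in (0 : ℝ)..1, inner ℝ (f (t + h * σ - h)) (w (t + h * σ)) := fun t =>
    continuous_average (c := fun h σ => inner ℝ (f (t + h * σ - h)) (w (t + h * σ)))
      (by simp only [Function.uncurry_def]; fun_prop)
  have hD := (hM t₂).sub (hM t₁)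
  have h := (hD.add (hD.comp continuous_neg)).tendsto 0
  simp only [Function.comp_def] at h
  refine h.mono_right (le_of_eq (congrArg 𝓝 ?_))
  simp
  ring

/-- Formally the limit is ∫⟨w - k, w'⟩ with k the primitive of k', integrated by parts. For f = w
the symmetric difference reproduces its own integral with opposite sign, so only boundary terms
survive; a forward difference would leave ‖w(s+h)-w(s)‖²/h, which is uncontrolled for a merely
continuous w. For k the difference is moved onto k, which is C¹. -/
theorem tendsto_integral_symmDiff [CompleteSpace H] {w k' : ℝ → H} (hw : Continuous w)
    (hk : Continuous k') (t₁ t₂ : ℝ) :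
    Tendsto (fun h : ℝ => (2 * h)⁻¹ * ∫ s in t₁..t₂,
        inner ℝ (w s - ∫ r in (0 : ℝ)..s, k' r) (w (s + h) - w (s - h)))
      (𝓝[>] 0) (𝓝 ((1 / 2 * ‖w t₂‖ ^ 2 - inner ℝ (∫ r in (0 : ℝ)..t₂, k' r) (w t₂)) -
        (1 / 2 * ‖w t₁‖ ^ 2 - inner ℝ (∫ r in (0 : ℝ)..t₁, k' r) (w t₁)) +
          ∫ s in t₁..t₂, inner ℝ (k' s) (w s))) := by
  set k : ℝ → H := fun s => ∫ r in (0 : ℝ)..s, k' r with hkdef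
  have hkc : Continuous k := intervalIntegral.continuous_primitive
    (fun a b => hk.intervalIntegrable a b) 0
  set L : ℝ → ℝ := fun h => ∫ s in t₁..t₂,
    inner ℝ (∫ σ in (0 : ℝ)..1, k' (s - h + (2 * h) * σ)) (w s) with hL
  have hLc : Continuous L := by
    have h1 : Continuous (fun q : ℝ × ℝ => ∫ σ in (0 : ℝ)..1, k' (q.2 - q.1 + (2 * q.1) * σ)) :=
      intervalIntegral.continuous_parametric_intervalIntegral_of_continuous'
        (f := fun (q : ℝ × ℝ) σ => k' (q.2 - q.1 + (2 * q.1) * σ))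
        (by simp only [Function.uncurry_def]; fun_prop) 0 1
    exact intervalIntegral.continuous_parametric_intervalIntegral_of_continuous'
      (f := fun h s => inner ℝ (∫ σ in (0 : ℝ)..1, k' (s - h + (2 * h) * σ)) (w s))
      (h1.inner (hw.comp continuous_snd)) t₁ t₂
  have hL0 : L 0 = ∫ s in t₁..t₂, inner ℝ (k' s) (w s) := by simp [hL]
  -- After division by 2h the factor is 1/4 for w, whose integral appears on both sides of the
  -- summation by parts, and 1/2 for k.
  have b1 := (tendsto_boundary hw hw t₁ t₂).const_mul (1 / 4)
  have b2 := (tendsto_boundary hkc hw t₁ t₂).const_mul (1 / 2)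
  have hlim := ((b1.sub b2).add (hLc.tendsto 0)).mono_left (nhdsWithin_le_nhds (s := Ioi 0))
  refine (hlim.congr' ?_).mono_right (le_of_eq (congrArg 𝓝 ?_))
  · filter_upwards [self_mem_nhdsWithin] with h (hh : 0 < h)
    have e1 := integral_inner_symmDiff hw hw t₁ t₂ h
    have e1' : ∫ s in t₁..t₂, inner ℝ (w (s + h) - w (s - h)) (w s) =
        ∫ s in t₁..t₂, inner ℝ (w s) (w (s + h) - w (s - h)) := by
      simp only [real_inner_comm]
    have e2 := integral_inner_symmDiff hkc hw t₁ t₂ h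
    have e2' : ∫ s in t₁..t₂, inner ℝ (k (s + h) - k (s - h)) (w s) = 2 * h * L h := by
      rw [hL, ← intervalIntegral.integral_const_mul]
      refine intervalIntegral.integral_congr fun s _ => ?_
      have e3 : k (s + h) - k (s - h) = ∫ r in (s - h)..(s - h + 2 * h), k' r := by
        rw [hkdef]
        simp only
        rw [intervalIntegral.integral_interval_sub_left (hk.intervalIntegrable _ _)
          (hk.intervalIntegrable _ _)]
        congr 1
        ring
      rw [e3, integral_eq_mul_average, real_inner_smul_left]
    have i1 : IntervalIntegrable (fun s => inner ℝ (w s) (w (s + h) - w (s - h))) volume t₁ t₂ :=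
      Continuous.intervalIntegrable (by fun_prop) _ _
    have i2 : IntervalIntegrable (fun s => inner ℝ (k s) (w (s + h) - w (s - h))) volume t₁ t₂ :=
      Continuous.intervalIntegrable (by fun_prop) _ _
    have e4 : ∫ s in t₁..t₂, inner ℝ (w s - k s) (w (s + h) - w (s - h)) =
        (∫ s in t₁..t₂, inner ℝ (w s) (w (s + h) - w (s - h))) -
          ∫ s in t₁..t₂, inner ℝ (k s) (w (s + h) - w (s - h)) := by
      rw [← intervalIntegral.integral_sub i1 i2]
      simp only [inner_sub_left]
    rw [e1'] at e1
    rw [e2'] at e2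
    rw [e4, e2, eq_inv_mul_iff_mul_eq₀ (by positivity)]
    linarith
  · rw [hL0, real_inner_self_eq_norm_sq, real_inner_self_eq_norm_sq]
    ring

end SymmetricDifference

/-! ### The memory functional and the energy in a Hilbert space -/

section Memory

variable {H : Type*} [NormedAddCommGroup H]

/-- The memory term `∫₀ᵗ γ(t-τ) ‖w(t) - w(τ)‖² dτ`. -/
noncomputable def memory (γ : ℝ → ℝ) (w : ℝ → H) (t : ℝ) : ℝ :=
  ∫ τ in (0 : ℝ)..t, γ (t - τ) * ‖w t - w τ‖ ^ 2

/-- The energy of a trajectory in a Hilbert space with memory kernel `g`. -/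
noncomputable def hilbertEnergy (g : ℝ → ℝ) (w : ℝ → H) (t : ℝ) : ℝ :=
  1 / 2 * memory g w t + 1 / 2 * (1 - ∫ s in (0 : ℝ)..t, g s) * ‖w t‖ ^ 2

variable {γ g ξ : ℝ → ℝ} {w : ℝ → H} {p : ℝ}

theorem memory_intervalIntegrable (hγ : IntegrableOn γ (Ioi 0)) (hw : Continuous w) {t : ℝ}
    (ht : 0 ≤ t) : IntervalIntegrable (fun τ => γ (t - τ) * ‖w t - w τ‖ ^ 2) volume 0 t :=
  conv_intervalIntegrable (f := fun τ => ‖w t - w τ‖ ^ 2) hγ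
    ((continuous_const.sub hw).norm.pow 2) ht

theorem memory_nonneg (hγ : ∀ t, 0 ≤ t → 0 ≤ γ t) {t : ℝ} (ht : 0 ≤ t) : 0 ≤ memory γ w t :=
  intervalIntegral.integral_nonneg ht fun τ hτ =>
    mul_nonneg (hγ _ (by linarith [hτ.2])) (by positivity)

variable [InnerProductSpace ℝ H] [CompleteSpace H]

/-- Expanding the square reduces the memory to convolutions, so continuity and differentiation in
time follow from those of `conv`, for g and for g' alike. -/
theorem memory_eq (hγ : IntegrableOn γ (Ioi 0)) (hw : Continuous w) {t : ℝ} (ht : 0 ≤ t) :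
    memory γ w t = (∫ σ in (0 : ℝ)..t, γ σ) * ‖w t‖ ^ 2 - 2 * inner ℝ (conv γ w t) (w t) +
      conv γ (fun τ => ‖w τ‖ ^ 2) t := by
  have i1 : IntervalIntegrable (fun τ => γ (t - τ) * ‖w t‖ ^ 2) volume 0 t :=
    (intervalIntegrable_comp_sub hγ ht).mul_const _
  have i2 := conv_intervalIntegrable hγ hw ht
  have i3 : IntervalIntegrable (fun τ => γ (t - τ) * ‖w τ‖ ^ 2) volume 0 t :=
    conv_intervalIntegrable (f := fun τ => ‖w τ‖ ^ 2) hγ (hw.norm.pow 2) ht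
  have i2' : IntervalIntegrable (fun τ => inner ℝ (w t) (γ (t - τ) • w τ)) volume 0 t := by
    rw [intervalIntegrable_iff] at i2 ⊢
    exact i2.const_inner (w t)
  have e1 : ∫ τ in (0 : ℝ)..t, γ (t - τ) * ‖w t‖ ^ 2 =
      (∫ σ in (0 : ℝ)..t, γ σ) * ‖w t‖ ^ 2 := by
    rw [intervalIntegral.integral_mul_const, intervalIntegral.integral_comp_sub_left γ t]
    simp
  have e2 : ∫ τ in (0 : ℝ)..t, inner ℝ (w t) (γ (t - τ) • w τ) =
      inner ℝ (conv γ w t) (w t) := by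
    rw [real_inner_comm, conv, intervalIntegral.integral_of_le ht,
      intervalIntegral.integral_of_le ht]
    exact integral_inner i2.1 (w t)
  have e3 : ∀ τ, γ (t - τ) * ‖w t - w τ‖ ^ 2 = γ (t - τ) * ‖w t‖ ^ 2 -
      2 * inner ℝ (w t) (γ (t - τ) • w τ) + γ (t - τ) * ‖w τ‖ ^ 2 := by
    intro τ
    rw [norm_sub_sq_real, real_inner_smul_right]
    ring
  unfold memory
  simp only [e3]
  rw [intervalIntegral.integral_add (i1.sub (i2'.const_mul 2)) i3,
    intervalIntegral.integral_sub i1 (i2'.const_mul 2), intervalIntegral.integral_const_mul, e1, e2]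
  rfl

theorem continuousOn_primitive_Ici (hγ : IntegrableOn γ (Ioi 0)) :
    ContinuousOn (fun t => ∫ σ in (0 : ℝ)..t, γ σ) (Ici 0) := by
  have h := conv_continuousOn hγ (f := fun _ => (1 : ℝ)) continuous_const (fun _ _ => rfl)
  refine h.congr fun t _ => ?_
  rw [conv_eq_comp_sub]
  simp

theorem memory_continuousOn (hγ : IntegrableOn γ (Ioi 0)) (hw : Continuous w)
    (hneg : ∀ s ≤ 0, w s = w 0) : ContinuousOn (memory γ w) (Ici 0) := by
  have c1 := continuousOn_primitive_Ici hγ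
  have c2 := conv_continuousOn hγ hw hneg
  have c3 := conv_continuousOn hγ (f := fun τ => ‖w τ‖ ^ 2) (hw.norm.pow 2)
    (fun s hs => by rw [hneg s hs])
  have h := ((c1.mul (hw.norm.pow 2).continuousOn).sub
    (continuousOn_const (c := (2 : ℝ)).mul (c2.inner hw.continuousOn))).add c3
  exact h.congr fun t ht => memory_eq hγ hw ht

theorem hilbertEnergy_continuousOn (hg : IntegrableOn g (Ioi 0)) (hw : Continuous w)
    (hneg : ∀ s ≤ 0, w s = w 0) : ContinuousOn (hilbertEnergy g w) (Ici 0) := by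
  have c1 := continuousOn_primitive_Ici hg
  have c2 := memory_continuousOn hg hw hneg
  exact (continuousOn_const.mul c2).add
    ((continuousOn_const.mul (continuousOn_const.sub c1)).mul (hw.norm.pow 2).continuousOn)

theorem hilbertEnergy_eq (hg : IntegrableOn g (Ioi 0)) (hw : Continuous w) {t : ℝ} (ht : 0 ≤ t) :
    hilbertEnergy g w t = 1 / 2 * ‖w t‖ ^ 2 - inner ℝ (conv g w t) (w t) +
      1 / 2 * conv g (fun τ => ‖w τ‖ ^ 2) t := by
  rw [hilbertEnergy, memory_eq hg hw ht]
  ring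

/-- The derivative of `conv g w`, extended to `ℝ` by its value at `0`. -/
noncomputable def convDeriv (g : ℝ → ℝ) (w : ℝ → H) (s : ℝ) : H :=
  g 0 • w (max s 0) + conv (deriv g) w (max s 0)

theorem convDeriv_continuous (hg : IsRelaxation g) (hp : DecayCondition g ξ p) (hw : Continuous w)
    (hneg : ∀ s ≤ 0, w s = w 0) : Continuous (convDeriv g w) := by
  have hm : Continuous fun s : ℝ => max s 0 := continuous_id.max continuous_const
  refine ((hw.comp hm).const_smul (g 0)).add ?_
  exact (conv_continuousOn (hp.integrableOn_deriv hg) hw hneg).comp_continuous hm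
    fun s => le_max_right s 0

theorem conv_eq_integral_convDeriv (hg : IsRelaxation g) (hp : DecayCondition g ξ p) (hw : Continuous w)
    (hneg : ∀ s ≤ 0, w s = w 0) {t : ℝ} (ht : 0 ≤ t) :
    conv g w t = ∫ s in (0 : ℝ)..t, convDeriv g w s := by
  rw [conv_eq_integral (hp.integrableOn_deriv hg) (fun t ht => hp.integral_deriv hg ht) hw hneg ht]
  refine intervalIntegral.integral_congr fun s hs => ?_
  rw [uIcc_of_le ht] at hs
  simp [convDeriv, max_eq_left hs.1]

/-- The bracket is exactly the limit in `tendsto_integral_symmDiff` with k = g * w, to be estimated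
through the equation. The rest is the explicit dissipation caused by the kernel. -/
theorem hilbertEnergy_sub (hg : IsRelaxation g) (hp : DecayCondition g ξ p) (hw : Continuous w)
    (hneg : ∀ s ≤ 0, w s = w 0) {t₁ t₂ : ℝ} (h1 : 0 ≤ t₁) (h2 : t₁ ≤ t₂) :
    hilbertEnergy g w t₂ - hilbertEnergy g w t₁ =
      ((1 / 2 * ‖w t₂‖ ^ 2 - inner ℝ (conv g w t₂) (w t₂)) -
        (1 / 2 * ‖w t₁‖ ^ 2 - inner ℝ (conv g w t₁) (w t₁)) +
          ∫ s in t₁..t₂, inner ℝ (convDeriv g w s) (w s)) +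
      ∫ s in t₁..t₂, (1 / 2 * memory (deriv g) w s - 1 / 2 * (g s * ‖w s‖ ^ 2)) := by
  have hd := hp.integrableOn_deriv hg
  have hN : Continuous fun τ => ‖w τ‖ ^ 2 := hw.norm.pow 2
  have hNneg : ∀ s ≤ 0, ‖w s‖ ^ 2 = ‖w 0‖ ^ 2 := fun s hs => by rw [hneg s hs]
  have hsub : uIcc t₁ t₂ ⊆ Ici 0 := by
    rw [uIcc_of_le h2]; exact fun x hx => h1.trans hx.1
  have c3 := conv_continuousOn hd hN hNneg
  have i1 : ∀ a b, 0 ≤ a → 0 ≤ b → IntervalIntegrable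
      (fun r => g 0 • ‖w r‖ ^ 2 + conv (deriv g) (fun τ => ‖w τ‖ ^ 2) r) volume a b := by
    intro a b ha hb
    refine ContinuousOn.intervalIntegrable (((hN.const_smul (g 0)).continuousOn.add c3).mono ?_)
    exact fun x hx => (le_min ha hb).trans hx.1
  have e1 : conv g (fun τ => ‖w τ‖ ^ 2) t₂ - conv g (fun τ => ‖w τ‖ ^ 2) t₁ =
      ∫ r in t₁..t₂, (g 0 • ‖w r‖ ^ 2 + conv (deriv g) (fun τ => ‖w τ‖ ^ 2) r) := by
    have hI := fun t ht => hp.integral_deriv hg (t := t) ht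
    rw [conv_eq_integral hd hI hN hNneg (h1.trans h2), conv_eq_integral hd hI hN hNneg h1,
      intervalIntegral.integral_interval_sub_left (i1 _ _ le_rfl (h1.trans h2))
        (i1 _ _ le_rfl h1)]
  have j1 : IntervalIntegrable (fun s => inner ℝ (convDeriv g w s) (w s)) volume t₁ t₂ :=
    ((convDeriv_continuous hg hp hw hneg).inner hw).intervalIntegrable _ _
  have j2 : IntervalIntegrable
      (fun s => 1 / 2 * memory (deriv g) w s - 1 / 2 * (g s * ‖w s‖ ^ 2)) volume t₁ t₂ := by
    refine ContinuousOn.intervalIntegrable (ContinuousOn.mono ?_ hsub)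
    exact (continuousOn_const.mul (memory_continuousOn hd hw hneg)).sub
      (continuousOn_const.mul (hg.continuousOn.mul hN.continuousOn))
  have e2 : (∫ s in t₁..t₂, inner ℝ (convDeriv g w s) (w s)) +
      (∫ s in t₁..t₂, (1 / 2 * memory (deriv g) w s - 1 / 2 * (g s * ‖w s‖ ^ 2))) =
      1 / 2 * ∫ r in t₁..t₂, (g 0 • ‖w r‖ ^ 2 + conv (deriv g) (fun τ => ‖w τ‖ ^ 2) r) := by
    rw [← intervalIntegral.integral_add j1 j2, ← intervalIntegral.integral_const_mul]
    refine intervalIntegral.integral_congr fun s hs => ?_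
    have hs0 : 0 ≤ s := hsub hs
    rw [memory_eq hd hw hs0, hp.integral_deriv hg hs0, convDeriv, max_eq_left hs0, inner_add_left,
      real_inner_smul_left, real_inner_self_eq_norm_sq, smul_eq_mul]
    ring
  rw [hilbertEnergy_eq hg.integrableOn hw (h1.trans h2), hilbertEnergy_eq hg.integrableOn hw h1]
  linarith

end Memory

/-! ### Comparison with solutions of an ordinary differential equation -/

section Comparison

/-- Comparison principle for `E' ≤ -φ E^q` in integrated form. -/
theorem le_of_integral_comparison {E B φ : ℝ → ℝ} {c q : ℝ} (hc : 0 ≤ c) (hq : 0 ≤ q)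
    (hE : ContinuousOn E (Ici 0)) (hB : ContinuousOn B (Ici 0)) (hφ : ContinuousOn φ (Ici 0))
    (hφ0 : ∀ t, 0 ≤ t → 0 ≤ φ t) (hB0 : ∀ t, 0 ≤ t → 0 ≤ B t) (h0 : E 0 < B 0)
    (hEi : ∀ s t, 0 < s → s ≤ t → E t + c * ∫ r in s..t, φ r * E r ^ q ≤ E s)
    (hBi : ∀ s t, 0 < s → s ≤ t → B s ≤ B t + c * ∫ r in s..t, φ r * B r ^ q) {t : ℝ}
    (ht : 0 ≤ t) : E t ≤ B t := by
  by_contra! hlt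
  have hS : IsCompact (Icc 0 t ∩ {s | s ∈ Icc 0 t ∧ E s ≤ B s}) := by
    refine isCompact_Icc.inter_right ?_
    exact isClosed_Icc.isClosed_le (hE.mono Icc_subset_Ici_self) (hB.mono Icc_subset_Ici_self)
  -- Take the last time s before t with E ≤ B. On (s,t] one has E > B, so E loses at least as much
  -- as B between s and t, which contradicts E(t) > B(t).
  obtain ⟨s, ⟨⟨-, hs, hsle⟩, hmax⟩⟩ := hS.exists_isGreatest ⟨0, ⟨le_rfl, ht⟩, ⟨le_rfl, ht⟩, h0.le⟩
  have hst : s < t := lt_of_le_of_ne hs.2 fun h => by rw [h] at hsle; linarith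
  have hgt : ∀ r, s < r → r ≤ t → B r < E r := by
    intro r h1 h2
    by_contra! h
    have h3 : r ∈ Icc 0 t := ⟨hs.1.trans h1.le, h2⟩
    exact absurd (hmax ⟨h3, h3, h⟩) (not_le.2 h1)
  -- The integral inequalities hold only from positive times; the strict inequality at 0 persists
  -- for a while and keeps s away from 0.
  have hs0 : 0 < s := by
    refine lt_of_le_of_ne hs.1 fun h => ?_
    have h1 : ContinuousWithinAt (fun r => B r - E r) (Ioi 0) 0 :=
      ((hB 0 self_mem_Ici).sub (hE 0 self_mem_Ici)).mono Ioi_subset_Ici_self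
    have h2 : ∀ᶠ r in 𝓝[>] (0 : ℝ), 0 < B r - E r :=
      h1.eventually (lt_mem_nhds (by linarith))
    have h3 : ∀ᶠ r in 𝓝[>] (0 : ℝ), r ∈ Ioo 0 t := Ioo_mem_nhdsGT (by linarith)
    obtain ⟨r, h4, h5⟩ := (h2.and h3).exists
    have := hgt r (by linarith [h5.1]) h5.2.le
    linarith
  have hsub : uIcc s t ⊆ Ici 0 := by
    rw [uIcc_of_le hst.le]; exact fun x hx => hs.1.trans hx.1
  have hmono : ∫ r in s..t, φ r * B r ^ q ≤ ∫ r in s..t, φ r * E r ^ q := by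
    refine intervalIntegral.integral_mono_on_of_le_Ioo hst.le
      ((hφ.mul (hB.rpow_const fun _ _ => Or.inr hq)).mono hsub).intervalIntegrable
      ((hφ.mul (hE.rpow_const fun _ _ => Or.inr hq)).mono hsub).intervalIntegrable fun r hr => ?_
    have hr0 : 0 ≤ r := hs.1.trans hr.1.le
    exact mul_le_mul_of_nonneg_left
      (Real.rpow_le_rpow (hB0 r hr0) (hgt r hr.1 hr.2.le).le hq) (hφ0 r hr0)
  have h1 := hEi s t hs0 hst.le
  have h2 := hBi s t hs0 hst.le
  nlinarith [mul_le_mul_of_nonneg_left hmono hc]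

theorem hasDerivAt_primitive_of_continuousOn {φ : ℝ → ℝ} (hφ : ContinuousOn φ (Ici 0)) {t : ℝ}
    (ht : 0 < t) : HasDerivAt (fun t => ∫ s in (0 : ℝ)..t, φ s) (φ t) t := by
  have hi : IntervalIntegrable φ volume 0 t :=
    (hφ.mono (by rw [uIcc_of_le ht.le]; exact Icc_subset_Ici_self)).intervalIntegrable
  refine intervalIntegral.integral_hasDerivAt_right hi ?_
    (hφ.continuousAt (Ici_mem_nhds ht))
  exact ContinuousOn.stronglyMeasurableAtFilter isOpen_Ioi (hφ.mono Ioi_subset_Ici_self) t ht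

theorem continuousOn_primitive_of_continuousOn {φ : ℝ → ℝ} (hφ : ContinuousOn φ (Ici 0)) :
    ContinuousOn (fun t => ∫ s in (0 : ℝ)..t, φ s) (Ici 0) := by
  have hc : Continuous fun s => φ (max s 0) :=
    hφ.comp_continuous (continuous_id.max continuous_const) fun s => le_max_right s 0
  refine (intervalIntegral.continuous_primitive (μ := volume) (fun a b => hc.intervalIntegrable a b)
    0).continuousOn.congr fun t ht => ?_
  refine intervalIntegral.integral_congr fun s hs => ?_
  rw [uIcc_of_le ht] at hs
  simp [max_eq_left hs.1]

variable {E φ : ℝ → ℝ} {c : ℝ}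

theorem exists_exp_decay (hc : 0 ≤ c) (hE : ContinuousOn E (Ici 0)) (hφ : ContinuousOn φ (Ici 0))
    (hφ0 : ∀ t, 0 ≤ t → 0 ≤ φ t) (hE0 : 0 ≤ E 0)
    (hEi : ∀ s t, 0 < s → s ≤ t → E t + c * ∫ r in s..t, φ r * E r ^ (1 : ℝ) ≤ E s) :
    ∃ K, 0 < K ∧ ∀ t, 0 ≤ t → E t ≤ K * Real.exp (-c * ∫ s in (0 : ℝ)..t, φ s) := by
  set B : ℝ → ℝ := fun t => (E 0 + 1) * Real.exp (-c * ∫ s in (0 : ℝ)..t, φ s) with hBdef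
  have hBc : ContinuousOn B (Ici 0) := continuousOn_const.mul
    (Real.continuous_exp.comp_continuousOn
      (continuousOn_const.mul (continuousOn_primitive_of_continuousOn hφ)))
  refine ⟨E 0 + 1, by linarith, fun t ht => ?_⟩
  refine le_of_integral_comparison (B := B) hc zero_le_one hE hBc hφ hφ0
    (fun t _ => mul_nonneg (by linarith) (Real.exp_pos _).le) (by simp [hBdef]) hEi ?_ ht
  intro s t hs hst
  have hsub : uIcc s t ⊆ Ici 0 := by
    rw [uIcc_of_le hst]; exact fun x hx => hs.le.trans hx.1
  have h := intervalIntegral.integral_eq_sub_of_hasDerivAt_of_le (f := B)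
    (f' := fun r => -c * (φ r * B r ^ (1 : ℝ))) hst
    (hBc.mono fun x hx => hs.le.trans hx.1) (fun x hx => ?_)
    ((continuousOn_const.mul (hφ.mul (hBc.rpow_const fun _ _ => Or.inr zero_le_one))).mono
      hsub).intervalIntegrable
  · rw [intervalIntegral.integral_const_mul] at h
    linarith
  · have hd := (((hasDerivAt_primitive_of_continuousOn hφ (hs.trans hx.1)).const_mul
      (-c)).exp).const_mul (E 0 + 1)
    refine hd.congr_deriv ?_
    rw [Real.rpow_one, hBdef]
    ring

/-- With Φ = 1 + ∫φ, the function B = KΦ^{-1/(q-1)} satisfies B' = -(K^{1-q}/(q-1)) φ B^q, hence is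
a supersolution once K^{1-q} ≤ c(q-1). -/
theorem exists_rpow_decay {q : ℝ} (hq : 1 < q) (hc : 0 < c) (hE : ContinuousOn E (Ici 0))
    (hφ : ContinuousOn φ (Ici 0)) (hφ0 : ∀ t, 0 ≤ t → 0 ≤ φ t) (hE0 : 0 ≤ E 0)
    (hEi : ∀ s t, 0 < s → s ≤ t → E t + c * ∫ r in s..t, φ r * E r ^ q ≤ E s) :
    ∃ K, 0 < K ∧ ∀ t, 0 ≤ t → E t ≤ K * (1 + ∫ s in (0 : ℝ)..t, φ s) ^ (-1 / (q - 1)) := by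
  have hq1 : 0 < q - 1 := by linarith
  have hcq : 0 < c * (q - 1) := mul_pos hc hq1
  -- The first entry puts B(0) strictly above E(0); the second gives K^{1-q} ≤ c(q-1), since 1 - q <
  -- 0.
  set K := max (E 0 + 1) ((c * (q - 1)) ^ (-1 / (q - 1))) with hK
  have hK0 : 0 < K := lt_of_lt_of_le (by linarith) (le_max_left _ _)
  have hKq : K ^ (1 - q) ≤ c * (q - 1) := by
    calc K ^ (1 - q) ≤ ((c * (q - 1)) ^ (-1 / (q - 1))) ^ (1 - q) :=
          Real.rpow_le_rpow_of_nonpos (Real.rpow_pos_of_pos hcq _) (le_max_right _ _) (by linarith)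
      _ = c * (q - 1) := by
          rw [← Real.rpow_mul hcq.le, show -1 / (q - 1) * (1 - q) = 1 by field_simp; ring,
            Real.rpow_one]
  set Φ : ℝ → ℝ := fun t => 1 + ∫ s in (0 : ℝ)..t, φ s with hΦ
  have hΦ1 : ∀ t, 0 ≤ t → 0 < Φ t := fun t ht => by
    have := intervalIntegral.integral_nonneg (μ := volume) ht fun x hx => hφ0 x hx.1
    simp only [hΦ]; linarith
  have hΦc : ContinuousOn Φ (Ici 0) :=
    continuousOn_const.add (continuousOn_primitive_of_continuousOn hφ)
  set B : ℝ → ℝ := fun t => K * Φ t ^ (-1 / (q - 1)) with hBdef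
  have hBc : ContinuousOn B (Ici 0) :=
    continuousOn_const.mul (hΦc.rpow_const fun x hx => Or.inl (hΦ1 x hx).ne')
  refine ⟨K, hK0, fun t ht => ?_⟩
  refine le_of_integral_comparison (B := B) hc.le (by linarith) hE hBc hφ hφ0
    (fun t ht => mul_nonneg hK0.le (Real.rpow_nonneg (hΦ1 t ht).le _)) ?_ hEi ?_ ht
  · simp only [hBdef, hΦ, intervalIntegral.integral_same, add_zero, Real.one_rpow, mul_one]
    exact lt_of_lt_of_le (by linarith) (le_max_left _ _)
  intro s t hs hst
  have hsub : uIcc s t ⊆ Ici 0 := by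
    rw [uIcc_of_le hst]; exact fun x hx => hs.le.trans hx.1
  have hi : IntervalIntegrable (fun r => φ r * B r ^ q) volume s t :=
    ((hφ.mul (hBc.rpow_const fun _ _ => Or.inr (by linarith))).mono hsub).intervalIntegrable
  have h := intervalIntegral.integral_eq_sub_of_hasDerivAt_of_le (f := B)
    (f' := fun r => -(K ^ (1 - q) / (q - 1)) * (φ r * B r ^ q)) hst
    (hBc.mono fun x hx => hs.le.trans hx.1) (fun x hx => ?_) (hi.const_mul _)
  · rw [intervalIntegral.integral_const_mul] at h
    have h1 : 0 ≤ ∫ r in s..t, φ r * B r ^ q := intervalIntegral.integral_nonneg hst fun r hr => by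
      have hr0 : 0 ≤ r := hs.le.trans hr.1
      exact mul_nonneg (hφ0 r hr0)
        (Real.rpow_nonneg (mul_nonneg hK0.le (Real.rpow_nonneg (hΦ1 r hr0).le _)) _)
    have h2 : K ^ (1 - q) / (q - 1) ≤ c := by rwa [div_le_iff₀ hq1]
    nlinarith [mul_le_mul_of_nonneg_right h2 h1]
  · have hx0 : 0 < x := hs.trans hx.1
    have hd := (((hasDerivAt_primitive_of_continuousOn hφ hx0).const_add 1).rpow_const
      (p := -1 / (q - 1)) (Or.inl (hΦ1 x hx0.le).ne')).const_mul K
    refine hd.congr_deriv ?_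
    have e1 : B x ^ q = K ^ q * Φ x ^ (-1 / (q - 1) - 1) := by
      rw [hBdef]
      simp only
      rw [Real.mul_rpow hK0.le (Real.rpow_nonneg (hΦ1 x hx0.le).le _),
        ← Real.rpow_mul (hΦ1 x hx0.le).le]
      congr 2
      field_simp
      ring
    have e2 : K ^ (1 - q) * K ^ q = K := by
      rw [← Real.rpow_add hK0, sub_add_cancel, Real.rpow_one]
    rw [e1]
    calc _ = -(K / (q - 1)) * (φ x * Φ x ^ (-1 / (q - 1) - 1)) := by simp only [hΦ]; ring
      _ = -(K ^ (1 - q) * K ^ q / (q - 1)) * (φ x * Φ x ^ (-1 / (q - 1) - 1)) := by rw [e2]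
      _ = _ := by ring

end Comparison

/-! ### Elementary bounds on the energy -/

section EnergyBounds

variable {H : Type*} [NormedAddCommGroup H] {g ξ : ℝ → ℝ} {w : ℝ → H} {p : ℝ}

theorem memory_deriv_nonpos (hg : IsRelaxation g) (hp : DecayCondition g ξ p)
    (hw : Continuous w) {t : ℝ} (ht : 0 ≤ t) : memory (deriv g) w t ≤ 0 := by
  have h := intervalIntegral.integral_mono_on_of_le_Ioo ht
    (memory_intervalIntegrable (hp.integrableOn_deriv hg) hw ht)
    (intervalIntegrable_const (c := (0 : ℝ))) fun τ hτ => ?_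
  · simpa [memory] using h
  · exact mul_nonpos_of_nonpos_of_nonneg (hp.deriv_nonpos hg (by linarith [hτ.2])) (by positivity)

theorem norm_sq_le_hilbertEnergy (hg : IsRelaxation g) {t : ℝ} (ht : 0 ≤ t) :
    (1 - ∫ s in Ioi (0 : ℝ), g s) / 2 * ‖w t‖ ^ 2 ≤ hilbertEnergy g w t := by
  have h1 := memory_nonneg (w := w) hg.nonneg ht
  have h2 := hg.integral_le ht
  have h3 := mul_le_mul_of_nonneg_right h2 (sq_nonneg ‖w t‖)
  unfold hilbertEnergy
  linarith

theorem hilbertEnergy_le (hg : IsRelaxation g) {t : ℝ} (ht : 0 ≤ t) :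
    hilbertEnergy g w t ≤ 1 / 2 * memory g w t + 1 / 2 * ‖w t‖ ^ 2 := by
  have h2 := hg.integral_nonneg ht
  have h3 := mul_nonneg h2 (sq_nonneg ‖w t‖)
  unfold hilbertEnergy
  linarith

theorem hilbertEnergy_nonneg (hg : IsRelaxation g) {t : ℝ} (ht : 0 ≤ t) :
    0 ≤ hilbertEnergy g w t :=
  (mul_nonneg (by linarith [hg.integral_lt]) (sq_nonneg _)).trans (norm_sq_le_hilbertEnergy hg ht)

end EnergyBounds

/-! ### Decay of dissipative trajectories -/

section Decay

variable {H : Type*} [NormedAddCommGroup H] {g ξ : ℝ → ℝ} {w : ℝ → H} {p : ℝ}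

/-- Splitting of the memory term with a free parameter, which replaces Hölder's inequality. -/
theorem mul_memory_le (hg : IsRelaxation g) (hp : DecayCondition g ξ p)
    (hw : Continuous w)
    {b : ℝ → ℝ} {q l t : ℝ} (hb : ContinuousOn b (Ici 0)) (ht : 0 ≤ t)
    (hle : ∀ σ, 0 < σ → ξ σ * g σ ≤ l * b σ + l ^ (1 - q) * -deriv g σ) :
    ξ t * memory g w t ≤ l * memory b w t + l ^ (1 - q) * -memory (deriv g) w t := by
  have ig := memory_intervalIntegrable hg.integrableOn hw ht
  have id := memory_intervalIntegrable (hp.integrableOn_deriv hg) hw ht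
  have ib : IntervalIntegrable (fun τ => b (t - τ) * ‖w t - w τ‖ ^ 2) volume 0 t := by
    refine ContinuousOn.intervalIntegrable ((hb.comp (continuous_const.sub
      continuous_id).continuousOn fun x hx => ?_).mul
        ((continuous_const.sub hw).norm.pow 2).continuousOn)
    rw [uIcc_of_le ht] at hx
    exact sub_nonneg.2 hx.2
  have hm := intervalIntegral.integral_mono_on_of_le_Ioo ht (ig.const_mul (ξ t))
    ((ib.const_mul l).add (id.neg.const_mul (l ^ (1 - q)))) fun τ hτ => ?_
  · rw [intervalIntegral.integral_add (ib.const_mul l) (id.neg.const_mul _),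
      intervalIntegral.integral_const_mul, intervalIntegral.integral_const_mul,
      intervalIntegral.integral_const_mul] at hm
    have e : ∫ τ in (0 : ℝ)..t, (-fun τ => deriv g (t - τ) * ‖w t - w τ‖ ^ 2) τ =
      -memory (deriv g) w t := intervalIntegral.integral_neg
    rwa [e] at hm
  · have h1 : 0 < t - τ := by linarith [hτ.2]
    -- Monotonicity of ξ carries the weight inside the memory integral, where it meets g at the same
    -- argument t - τ.
    have h2 : ξ t ≤ ξ (t - τ) := hp.antitoneOn h1.le ht (by linarith [hτ.1])
    have h3 := mul_le_mul_of_nonneg_right h2 (hg.nonneg _ h1.le)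
    have h4 := mul_le_mul_of_nonneg_right (h3.trans (hle _ h1)) (sq_nonneg ‖w t - w τ‖)
    simp only [Pi.neg_apply]
    linarith

variable [InnerProductSpace ℝ H]

/-- A trajectory in a Hilbert space that satisfies the energy inequality with memory kernel `g`
and dissipation `P`. -/
structure IsDissipative (g : ℝ → ℝ) (w : ℝ → H) (P : ℝ → ℝ) : Prop where
  continuous : Continuous w
  eq_zero_time : ∀ s ≤ 0, w s = w 0
  nonneg : ∀ t, 0 < t → 0 ≤ P t
  continuousOn : ContinuousOn P (Ioi 0)
  energy_le : ∀ s t, 0 < s → s ≤ t →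
    hilbertEnergy g w t + ∫ r in s..t, (P r - 1 / 2 * memory (deriv g) w r) ≤ hilbertEnergy g w s

variable [CompleteSpace H] {P : ℝ → ℝ}

theorem IsDissipative.antitoneOn (h : IsDissipative g w P) (hg : IsRelaxation g)
    (hp : DecayCondition g ξ p) : AntitoneOn (hilbertEnergy g w) (Ici 0) := by
  have hpos : ∀ s t, 0 < s → s ≤ t → hilbertEnergy g w t ≤ hilbertEnergy g w s := by
    intro s t hs hst
    have h1 := h.energy_le s t hs hst
    have h2 : 0 ≤ ∫ r in s..t, (P r - 1 / 2 * memory (deriv g) w r) :=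
      intervalIntegral.integral_nonneg hst fun r hr => by
        have hr0 := hs.trans_le hr.1
        linarith [h.nonneg r hr0, memory_deriv_nonpos hg hp h.continuous hr0.le]
    linarith
  intro s hs t ht hst
  rcases (mem_Ici.1 hs).eq_or_lt with rfl | hs0
  · rcases hst.eq_or_lt with rfl | ht0
    · exact le_rfl
    -- The energy inequality starts from positive times; continuity of the energy at 0 covers the
    -- initial time.
    have hc := hilbertEnergy_continuousOn hg.integrableOn h.continuous h.eq_zero_time
    refine ge_of_tendsto ((hc 0 self_mem_Ici).mono Ioi_subset_Ici_self) ?_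
    filter_upwards [Ioo_mem_nhdsGT ht0] with r hr
    exact hpos r t hr.1 hr.2.le
  · exact hpos s t hs0 hst

/-- Both ‖w(s)‖² and ‖w(t)‖² are at most 2E(s)/(1 - ∫g), because E is nonincreasing. Bounding by the
energy at the earlier time is what makes the memory integral of a constant kernel finite when E is
integrable. -/
theorem IsDissipative.norm_sub_sq_le (h : IsDissipative g w P) (hg : IsRelaxation g)
    (hp : DecayCondition g ξ p) {s t : ℝ} (hs : 0 ≤ s) (hst : s ≤ t) :
    ‖w t - w s‖ ^ 2 ≤ 8 / (1 - ∫ s in Ioi (0 : ℝ), g s) * hilbertEnergy g w s := by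
  have hl := hg.integral_lt
  have h1 := norm_sq_le_hilbertEnergy (w := w) hg hs
  have h2 := norm_sq_le_hilbertEnergy (w := w) hg (hs.trans hst)
  have h3 := h.antitoneOn hg hp hs (hs.trans hst) hst
  have h4 : ‖w t - w s‖ ^ 2 ≤ 2 * (‖w t‖ ^ 2 + ‖w s‖ ^ 2) := by
    have h5 := norm_sub_le (w t) (w s)
    nlinarith [norm_nonneg (w t - w s), sq_nonneg (‖w t‖ - ‖w s‖)]
  rw [div_mul_eq_mul_div, le_div_iff₀ hl]
  nlinarith [mul_le_mul_of_nonneg_right h4 hl.le]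

/-- The differential inequality `(ξE)^q ≤ C X` for the dissipation rate `X`. -/
theorem IsDissipative.exists_rpow_le (h : IsDissipative g w P) (hg : IsRelaxation g)
    (hp : DecayCondition g ξ p) {C₀ : ℝ} (hC₀ : 0 < C₀)
    (hstab : ∀ᵐ t, 0 < t → hilbertEnergy g w t ≤ C₀ * (P t + memory g w t))
    {b : ℝ → ℝ} {q M : ℝ} (hq : 1 ≤ q) (hM : 0 ≤ M) (hb : ContinuousOn b (Ici 0))
    (hle : ∀ l, 0 < l → ∀ σ, 0 < σ → ξ σ * g σ ≤ l * b σ + l ^ (1 - q) * -deriv g σ)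
    (hbM : ∀ t, 0 ≤ t → memory b w t ≤ M) :
    ∃ C, 0 < C ∧ ∀ᵐ t, 0 < t →
      (ξ t * hilbertEnergy g w t) ^ q ≤ C * (P t - 1 / 2 * memory (deriv g) w t) := by
  set E := hilbertEnergy g w with hE
  have hE0 : ∀ t, 0 ≤ t → 0 ≤ E t := fun t ht => hilbertEnergy_nonneg hg ht
  have hξ0 := hp.nonneg 0 le_rfl
  -- The free parameter will be e/R with e = ξE; this R makes C₀(e/R)M ≤ e/2, which is absorbed.
  -- Adding 1 to M keeps R positive when M = 0.
  set R := 2 * C₀ * (M + 1) with hR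
  have hR0 : 0 < R := by positivity
  set C := 2 * (C₀ * ξ 0 * (ξ 0 * E 0) ^ (q - 1) + 2 * C₀ * R ^ (q - 1)) with hC
  have hC0 : 0 < C := by
    have h1 : 0 ≤ (ξ 0 * E 0) ^ (q - 1) := Real.rpow_nonneg (mul_nonneg hξ0 (hE0 0 le_rfl)) _
    have h2 : 0 < R ^ (q - 1) := Real.rpow_pos_of_pos hR0 _
    have h3 : 0 < 2 * C₀ * R ^ (q - 1) := by positivity
    have h4 : 0 ≤ C₀ * ξ 0 * (ξ 0 * E 0) ^ (q - 1) := by positivity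
    linarith
  refine ⟨C, hC0, hstab.mono fun t hst ht => ?_⟩
  have hξt := hp.nonneg t ht.le
  have hd := memory_deriv_nonpos hg hp h.continuous ht.le
  have hP := h.nonneg t ht
  set X := P t - 1 / 2 * memory (deriv g) w t with hX
  have hX0 : 0 ≤ X := by linarith
  set e := ξ t * E t with he
  rcases (mul_nonneg hξt (hE0 t ht.le)).eq_or_lt with h0 | hpos
  · rw [he, ← h0, Real.zero_rpow (by linarith)]
    exact mul_nonneg hC0.le hX0
  change 0 < e at hpos
  have hl : 0 < e / R := div_pos hpos hR0
  have h1 := mul_memory_le hg hp h.continuous hb ht.le (hle (e / R) hl)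
  have h2 := mul_le_mul_of_nonneg_left (hbM t ht.le) hl.le
  -- Multiplying by e^{q-1} cancels the negative power of e in the coefficient of X. This is the
  -- origin of the q-th power in the conclusion.
  have hlq : (e / R) ^ (1 - q) * e ^ (q - 1) = R ^ (q - 1) := by
    rw [Real.div_rpow hpos.le hR0.le, show 1 - q = -(q - 1) by ring, Real.rpow_neg hpos.le,
      Real.rpow_neg hR0.le]
    have := (Real.rpow_pos_of_pos hpos (q - 1)).ne'
    field_simp
  have hlq0 : 0 ≤ (e / R) ^ (1 - q) := Real.rpow_nonneg hl.le _
  have h3 : e ≤ C₀ * ξ t * X + C₀ * (e / R * M + (e / R) ^ (1 - q) * (2 * X)) := by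
    have h4 := mul_le_mul_of_nonneg_left (hst ht) hξt
    have h5 : -memory (deriv g) w t ≤ 2 * X := by linarith
    have h6 := mul_le_mul_of_nonneg_left h5 hlq0
    have h7 : ξ t * P t ≤ ξ t * X := mul_le_mul_of_nonneg_left (by linarith) hξt
    have h8 : ξ t * memory g w t ≤ e / R * M + (e / R) ^ (1 - q) * (2 * X) := by linarith
    nlinarith [mul_le_mul_of_nonneg_left h7 hC₀.le, mul_le_mul_of_nonneg_left h8 hC₀.le]
  have h4 : C₀ * (e / R * M) ≤ e / 2 := by
    rw [hR]
    have : C₀ * (e / (2 * C₀ * (M + 1)) * M) = e / 2 * (M / (M + 1)) := by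
      field_simp
    rw [this]
    have hM1 : M / (M + 1) ≤ 1 := by rw [div_le_one (by linarith)]; linarith
    nlinarith
  have h5 : e / 2 ≤ (C₀ * ξ t + 2 * C₀ * (e / R) ^ (1 - q)) * X := by nlinarith
  have hξm : ξ t ≤ ξ 0 := hp.antitoneOn self_mem_Ici ht.le ht.le
  have heb : e ^ (q - 1) ≤ (ξ 0 * E 0) ^ (q - 1) := by
    refine Real.rpow_le_rpow hpos.le ?_ (by linarith)
    exact mul_le_mul hξm (h.antitoneOn hg hp self_mem_Ici ht.le ht.le) (hE0 t ht.le) hξ0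
  have he0 : 0 ≤ e ^ (q - 1) := Real.rpow_nonneg hpos.le _
  calc e ^ q = e ^ (q - 1) * e := by
        rw [← Real.rpow_add_one hpos.ne', sub_add_cancel]
    _ ≤ 2 * ((C₀ * ξ t * e ^ (q - 1) + 2 * C₀ * ((e / R) ^ (1 - q) * e ^ (q - 1))) * X) := by
        have := mul_le_mul_of_nonneg_left h5 he0
        linarith
    _ ≤ C * X := by
        rw [hlq, hC]
        have h6 : ξ t * e ^ (q - 1) ≤ ξ 0 * (ξ 0 * E 0) ^ (q - 1) := mul_le_mul hξm heb he0 hξ0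
        have h7 := mul_le_mul_of_nonneg_left h6 hC₀.le
        have h8 := mul_le_mul_of_nonneg_right h7 hX0
        linarith

/-- The pointwise bound (ξE)^q ≤ CX, inserted under the integral of the energy inequality. An
almost-everywhere bound suffices there. -/
theorem IsDissipative.exists_integral_ineq (h : IsDissipative g w P) (hg : IsRelaxation g)
    (hp : DecayCondition g ξ p) {C₀ : ℝ} (hC₀ : 0 < C₀)
    (hstab : ∀ᵐ t, 0 < t → hilbertEnergy g w t ≤ C₀ * (P t + memory g w t))
    {b : ℝ → ℝ} {q M : ℝ} (hq : 1 ≤ q) (hM : 0 ≤ M) (hb : ContinuousOn b (Ici 0))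
    (hle : ∀ l, 0 < l → ∀ σ, 0 < σ → ξ σ * g σ ≤ l * b σ + l ^ (1 - q) * -deriv g σ)
    (hbM : ∀ t, 0 ≤ t → memory b w t ≤ M) :
    ∃ c, 0 < c ∧ ∀ s t, 0 < s → s ≤ t →
      hilbertEnergy g w t + c * ∫ r in s..t, ξ r ^ q * hilbertEnergy g w r ^ q ≤
        hilbertEnergy g w s := by
  obtain ⟨C, hC, hae⟩ := h.exists_rpow_le hg hp hC₀ hstab hq hM hb hle hbM
  refine ⟨C⁻¹, inv_pos.2 hC, fun s t hs hst => ?_⟩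
  refine le_trans ?_ (h.energy_le s t hs hst)
  have hsub : uIcc s t ⊆ Ioi 0 := by
    rw [uIcc_of_le hst]; exact fun x hx => hs.trans_le hx.1
  have hEc := hilbertEnergy_continuousOn hg.integrableOn h.continuous h.eq_zero_time
  have hq0 : 0 ≤ q := by linarith
  rw [← intervalIntegral.integral_const_mul]
  gcongr
  refine intervalIntegral.integral_mono_ae_restrict hst ?_ ?_ ?_
  · refine ContinuousOn.intervalIntegrable (ContinuousOn.mono ?_ (hsub.trans Ioi_subset_Ici_self))
    exact continuousOn_const.mul ((hp.differentiableOn.continuousOn.rpow_const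
      fun _ _ => Or.inr hq0).mul (hEc.rpow_const fun _ _ => Or.inr hq0))
  · refine ContinuousOn.intervalIntegrable (ContinuousOn.mono ?_ hsub)
    exact h.continuousOn.sub (continuousOn_const.mul ((memory_continuousOn
      (hp.integrableOn_deriv hg) h.continuous h.eq_zero_time).mono Ioi_subset_Ici_self))
  · filter_upwards [ae_restrict_of_ae hae, ae_restrict_mem measurableSet_Icc] with r hr hr'
    have hr0 : 0 < r := hs.trans_le hr'.1
    rw [← Real.mul_rpow (hp.nonneg r hr0.le) (hilbertEnergy_nonneg hg hr0.le),
      inv_mul_le_iff₀ hC]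
    exact hr hr0

/-- For p = 1 the condition on g' already says ξg ≤ -g': no splitting is needed, so b = 0, M = 0 and
q = 1. -/
theorem IsDissipative.exp_decay (h : IsDissipative g w P) (hg : IsRelaxation g)
    (hp : DecayCondition g ξ p) {C₀ : ℝ} (hC₀ : 0 < C₀)
    (hstab : ∀ᵐ t, 0 < t → hilbertEnergy g w t ≤ C₀ * (P t + memory g w t)) (hp1 : p = 1) :
    ∃ K c, 0 < K ∧ 0 < c ∧ ∀ t, 0 ≤ t →
      hilbertEnergy g w t ≤ K * Real.exp (-c * ∫ s in (0 : ℝ)..t, ξ s) := by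
  subst hp1
  obtain ⟨c, hc, hi⟩ := h.exists_integral_ineq hg hp hC₀ hstab (b := fun _ => 0) (q := 1)
    (M := 0) le_rfl le_rfl continuousOn_const (fun l _ σ hσ => by
      have := hp.deriv_le_of_pos hσ
      simp only [Real.rpow_one] at this
      simp only [mul_zero, sub_self, Real.rpow_zero, one_mul, zero_add]
      linarith) (fun t _ => by simp [memory])
  simp only [Real.rpow_one] at hi
  obtain ⟨K, hK, hdec⟩ := exists_exp_decay hc.le
    (hilbertEnergy_continuousOn hg.integrableOn h.continuous h.eq_zero_time)
    hp.differentiableOn.continuousOn hp.nonneg (hilbertEnergy_nonneg hg le_rfl)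
    (fun s t hs hst => by simpa only [Real.rpow_one] using hi s t hs hst)
  exact ⟨K, c, hK, hc, hdec⟩

/-- Here b = ξ√g and q = 2p-1. The memory with kernel b is bounded since ‖w(t)-w(τ)‖² is bounded by
the initial energy and b has bounded integrals. -/
theorem IsDissipative.rpow_decay (h : IsDissipative g w P) (hg : IsRelaxation g)
    (hp : DecayCondition g ξ p) {C₀ : ℝ} (hC₀ : 0 < C₀)
    (hstab : ∀ᵐ t, 0 < t → hilbertEnergy g w t ≤ C₀ * (P t + memory g w t)) (hp1 : 1 < p) :
    ∃ K, 0 < K ∧ ∀ t, 0 ≤ t → hilbertEnergy g w t ≤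
      K * (1 + ∫ s in (0 : ℝ)..t, ξ s ^ (2 * p - 1)) ^ (-1 / (2 * p - 2)) := by
  obtain ⟨M, hM, hint⟩ := hp.exists_integral_sqrt_le hg
  have hl := hg.integral_lt
  set D := 8 / (1 - ∫ s in Ioi (0 : ℝ), g s) * hilbertEnergy g w 0 with hD
  have hD0 : 0 ≤ D := mul_nonneg (by positivity) (hilbertEnergy_nonneg hg le_rfl)
  have hb : ContinuousOn (fun s => ξ s * g s ^ (1 / 2 : ℝ)) (Ici 0) :=
    hp.differentiableOn.continuousOn.mul
      (hg.continuousOn.rpow_const fun _ _ => Or.inr (by norm_num))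
  have hkey : ∃ c, 0 < c ∧ ∀ s t, 0 < s → s ≤ t → hilbertEnergy g w t +
      c * ∫ r in s..t, ξ r ^ (2 * p - 1) * hilbertEnergy g w r ^ (2 * p - 1) ≤
        hilbertEnergy g w s := by
    refine h.exists_integral_ineq hg hp hC₀ hstab
      (b := fun s => ξ s * g s ^ (1 / 2 : ℝ)) (q := 2 * p - 1) (M := M * D) (by linarith)
      (mul_nonneg hM hD0) hb ?_ ?_
    · intro l hl σ hσ
      have h1 := hp.deriv_le_of_pos hσ
      have hξ := hp.nonneg σ hσ.le
      have hg0 := hg.nonneg σ hσ.le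
      -- According to whether √g ≤ l or √g ≥ l, one of the two terms alone suffices, because g =
      -- √g·√g = (√g)^{2-2p} g^p and 2 - 2p < 0.
      have key : g σ ≤ l * g σ ^ (1 / 2 : ℝ) + l ^ (1 - (2 * p - 1)) * g σ ^ p := by
        rcases le_total (g σ ^ (1 / 2 : ℝ)) l with hle | hle
        · have h2 : g σ = g σ ^ (1 / 2 : ℝ) * g σ ^ (1 / 2 : ℝ) := by
            rw [← Real.sqrt_eq_rpow, Real.mul_self_sqrt hg0]
          have h3 : 0 ≤ l ^ (1 - (2 * p - 1)) * g σ ^ p := by positivity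
          have h4 := mul_le_mul_of_nonneg_right hle (Real.rpow_nonneg hg0 (1 / 2 : ℝ))
          linarith
        · have hgp : 0 < g σ := by
            rcases hg0.eq_or_lt with h0 | h0
            · rw [← h0, Real.zero_rpow (by norm_num)] at hle; linarith
            · exact h0
          have h2 : g σ = (g σ ^ (1 / 2 : ℝ)) ^ (1 - (2 * p - 1)) * g σ ^ p := by
            rw [← Real.rpow_mul hg0, ← Real.rpow_add hgp,
              show 1 / 2 * (1 - (2 * p - 1)) + p = 1 by ring, Real.rpow_one]
          have h3 := mul_le_mul_of_nonneg_right
            (Real.rpow_le_rpow_of_nonpos hl hle (by linarith : 1 - (2 * p - 1) ≤ 0))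
            (Real.rpow_nonneg hg0 p)
          have h4 : 0 ≤ l * g σ ^ (1 / 2 : ℝ) := by positivity
          linarith
      have h2 := mul_le_mul_of_nonneg_left key hξ
      have h3 := mul_le_mul_of_nonneg_left h1 (Real.rpow_nonneg hl.le (1 - (2 * p - 1)))
      linarith
    · intro t ht
      have hbt : ContinuousOn (fun τ => ξ (t - τ) * g (t - τ) ^ (1 / 2 : ℝ)) (uIcc 0 t) := by
        refine hb.comp (continuous_const.sub continuous_id).continuousOn fun x hx => ?_
        rw [uIcc_of_le ht] at hx
        exact sub_nonneg.2 hx.2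
      have h1 : memory (fun s => ξ s * g s ^ (1 / 2 : ℝ)) w t ≤
          ∫ τ in (0 : ℝ)..t, ξ (t - τ) * g (t - τ) ^ (1 / 2 : ℝ) * D := by
        refine intervalIntegral.integral_mono_on ht (ContinuousOn.intervalIntegrable (hbt.mul
          ((continuous_const.sub h.continuous).norm.pow 2).continuousOn))
          (hbt.intervalIntegrable.mul_const D) fun τ hτ => ?_
        have h2 := h.norm_sub_sq_le hg hp hτ.1 hτ.2
        have h3 := h.antitoneOn hg hp self_mem_Ici hτ.1 hτ.1
        have h4 : 0 ≤ t - τ := by linarith [hτ.2]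
        refine mul_le_mul_of_nonneg_left (h2.trans ?_) (mul_nonneg (hp.nonneg _ h4)
          (Real.rpow_nonneg (hg.nonneg _ h4) _))
        exact mul_le_mul_of_nonneg_left h3 (by positivity)
      rw [intervalIntegral.integral_mul_const, intervalIntegral.integral_comp_sub_left
        (fun s => ξ s * g s ^ (1 / 2 : ℝ)) t, sub_self, sub_zero] at h1
      exact h1.trans (mul_le_mul_of_nonneg_right (hint t ht) hD0)
  obtain ⟨c, hc, hi⟩ := hkey
  obtain ⟨K, hK, hdec⟩ := exists_rpow_decay (q := 2 * p - 1) (by linarith) hc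
    (hilbertEnergy_continuousOn hg.integrableOn h.continuous h.eq_zero_time)
    (hp.differentiableOn.continuousOn.rpow_const fun _ _ => Or.inr (by linarith))
    (fun t ht => Real.rpow_nonneg (hp.nonneg t ht) _) (hilbertEnergy_nonneg hg le_rfl) hi
  refine ⟨K, hK, fun t ht => ?_⟩
  rw [show 2 * p - 2 = 2 * p - 1 - 1 by ring]
  exact hdec t ht

/-- A bootstrap: the rate of `rpow_decay` is integrable, so ∫E(τ)dτ is finite and dominates
∫‖w(t)-w(τ)‖²dτ. The kernel b may then be the constant ξ(0), and the exponent drops from 2p-1 to p.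
-/
theorem IsDissipative.rpow_decay_of_integrable (h : IsDissipative g w P) (hg : IsRelaxation g)
    (hp : DecayCondition g ξ p) {C₀ : ℝ} (hC₀ : 0 < C₀)
    (hstab : ∀ᵐ t, 0 < t → hilbertEnergy g w t ≤ C₀ * (P t + memory g w t)) (hp1 : 1 < p)
    (hrate : IntegrableRate ξ p) :
    ∃ K, 0 < K ∧ ∀ t, 0 ≤ t → hilbertEnergy g w t ≤
      K * (1 + ∫ s in (0 : ℝ)..t, ξ s ^ p) ^ (-1 / (p - 1)) := by
  obtain ⟨K, hK, hdec⟩ := h.rpow_decay hg hp hC₀ hstab hp1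
  have hl := hg.integral_lt
  have hξ0 := hp.nonneg 0 le_rfl
  set ρ : ℝ → ℝ := fun t => (1 + ∫ s in (0 : ℝ)..t, ξ s ^ (2 * p - 1)) ^ (-1 / (2 * p - 2))
    with hρ
  have hρ0 : ∀ t, 0 ≤ t → 0 ≤ ρ t := fun t ht => by
    refine Real.rpow_nonneg ?_ _
    have := intervalIntegral.integral_nonneg (μ := volume) ht fun x hx =>
      Real.rpow_nonneg (hp.nonneg x hx.1) (2 * p - 1)
    linarith
  have hρi : IntegrableOn ρ (Ioi 0) := hrate
  set D := 8 / (1 - ∫ s in Ioi (0 : ℝ), g s) with hD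
  have hD0 : 0 < D := by positivity
  have hI0 : 0 ≤ ∫ t in Ioi (0 : ℝ), ρ t :=
    setIntegral_nonneg measurableSet_Ioi fun t ht => hρ0 t (le_of_lt ht)
  have hEc := hilbertEnergy_continuousOn hg.integrableOn h.continuous h.eq_zero_time
  have hkey : ∃ c, 0 < c ∧ ∀ s t, 0 < s → s ≤ t → hilbertEnergy g w t +
      c * ∫ r in s..t, ξ r ^ p * hilbertEnergy g w r ^ p ≤ hilbertEnergy g w s := by
    refine h.exists_integral_ineq hg hp hC₀ hstab
      (b := fun _ => ξ 0) (q := p) (M := ξ 0 * (D * (K * ∫ t in Ioi (0 : ℝ), ρ t))) hp1.le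
      (by positivity) continuousOn_const ?_ ?_
    · intro l hl σ hσ
      have h1 := hp.deriv_le_of_pos hσ
      have hξ := hp.nonneg σ hσ.le
      have hξle : ξ σ ≤ ξ 0 := hp.antitoneOn self_mem_Ici hσ.le hσ.le
      have hg0 := hg.nonneg σ hσ.le
      have key : g σ ≤ l + l ^ (1 - p) * g σ ^ p := by
        rcases le_total (g σ) l with hle | hle
        · have h3 : 0 ≤ l ^ (1 - p) * g σ ^ p := by positivity
          linarith
        · have hgp : 0 < g σ := hl.trans_le hle
          have h2 : g σ = g σ ^ (1 - p) * g σ ^ p := by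
            rw [← Real.rpow_add hgp, sub_add_cancel, Real.rpow_one]
          have h3 := mul_le_mul_of_nonneg_right
            (Real.rpow_le_rpow_of_nonpos hl hle (by linarith : 1 - p ≤ 0)) (Real.rpow_nonneg hg0 p)
          linarith
      have h2 := mul_le_mul_of_nonneg_left key hξ
      have h3 := mul_le_mul_of_nonneg_left h1 (Real.rpow_nonneg hl.le (1 - p))
      have h4 := mul_le_mul_of_nonneg_left hξle hl.le
      linarith
    · intro t ht
      have hsub : uIcc 0 t ⊆ Ici 0 := by rw [uIcc_of_le ht]; exact Icc_subset_Ici_self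
      have hEi : IntervalIntegrable (hilbertEnergy g w) volume 0 t :=
        (hEc.mono hsub).intervalIntegrable
      have h1 : memory (fun _ => ξ 0) w t ≤
          ∫ τ in (0 : ℝ)..t, ξ 0 * (D * (K * ρ τ)) := by
        refine intervalIntegral.integral_mono_on ht (Continuous.intervalIntegrable
          (continuous_const.mul ((continuous_const.sub h.continuous).norm.pow 2)) _ _)
          ((((intervalIntegrable_of_Ioi hρi le_rfl ht).const_mul K).const_mul D).const_mul (ξ 0))
          fun τ hτ => ?_
        have h2 := h.norm_sub_sq_le hg hp hτ.1 hτ.2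
        exact mul_le_mul_of_nonneg_left (h2.trans (mul_le_mul_of_nonneg_left (hdec τ hτ.1) hD0.le))
          hξ0
      simp only [intervalIntegral.integral_const_mul] at h1
      refine h1.trans ?_
      have h3 : ∫ τ in (0 : ℝ)..t, ρ τ ≤ ∫ t in Ioi (0 : ℝ), ρ t := by
        rw [intervalIntegral.integral_of_le ht]
        refine setIntegral_mono_set hρi ?_ (ae_of_all _ fun x hx => hx.1)
        exact (ae_restrict_mem measurableSet_Ioi).mono fun x hx => hρ0 x (le_of_lt hx)
      gcongr
  obtain ⟨c, hc, hi⟩ := hkey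
  exact exists_rpow_decay hp1 hc hEc
    (hp.differentiableOn.continuousOn.rpow_const fun _ _ => Or.inr (by linarith))
    (fun t ht => Real.rpow_nonneg (hp.nonneg t ht) _) (hilbertEnergy_nonneg hg le_rfl) hi

end Decay

/-! ### Sobolev–Poincaré inequality on H₀¹ -/

section Sobolev

theorem norm_fderiv_le_norm_grad {n : ℕ} (φ : Vec n → Vec n) (x : Vec n) :
    ‖fderiv ℝ φ x‖ ≤ ‖grad φ x‖ := by
  refine ContinuousLinearMap.opNorm_le_bound _ (norm_nonneg _) fun v => ?_
  have hv : v = ∑ j, v j • EuclideanSpace.single j (1 : ℝ) := by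
    have h := (EuclideanSpace.basisFun (Fin n) ℝ).sum_repr v
    simpa using h.symm
  have hcomp : ∀ i, fderiv ℝ φ x v i = ∑ j, v j * grad φ x (i, j) := by
    intro i
    conv_lhs => rw [hv]
    simp [grad, map_sum]
  refine le_of_sq_le_sq ?_ (by positivity)
  rw [mul_pow, EuclideanSpace.norm_sq_eq, EuclideanSpace.norm_sq_eq, EuclideanSpace.norm_sq_eq,
    Fintype.sum_prod_type, Finset.sum_mul]
  refine Finset.sum_le_sum fun i _ => ?_
  rw [hcomp]
  simp only [Real.norm_eq_abs, sq_abs]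
  rw [mul_comm]
  exact Finset.sum_mul_sq_le_sq_mul_sq _ _ _

/-- In dimension one the Gagliardo–Nirenberg–Sobolev inequality with q < n is empty; the fundamental
theorem of calculus along the line replaces it. The map s ↦ s·e identifies ℝ with `Vec 1` and
preserves measure. -/
theorem enorm_le_lintegral_fderiv_one {φ : Vec 1 → Vec 1} (hφ : ContDiff ℝ 1 φ)
    (hc : HasCompactSupport φ) (x : Vec 1) : ‖φ x‖ₑ ≤ ∫⁻ y, ‖fderiv ℝ φ y‖ₑ := by
  set e : Vec 1 := EuclideanSpace.single 0 1 with he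
  have hmp : MeasurePreserving (fun s : ℝ => s • e) := by
    have h := (PiLp.volume_preserving_toLp (Fin 1)).comp
      (volume_preserving_funUnique (Fin 1) ℝ).symm
    have heq : (fun s : ℝ => s • e) =
        WithLp.toLp 2 ∘ (MeasurableEquiv.funUnique (Fin 1) ℝ).symm := by
      funext s
      ext i
      fin_cases i
      simp [he]
    rw [heq]
    exact h
  have hx : x = (x 0) • e := by
    ext i
    fin_cases i
    simp [he]
  have hcd : ContDiff ℝ 1 fun s : ℝ => φ (s • e) := hφ.comp (contDiff_id.smul contDiff_const)
  have hcs : HasCompactSupport fun s : ℝ => φ (s • e) := by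
    refine hc.comp_isClosedEmbedding (g := fun s : ℝ => s • e) ?_
    exact isClosedEmbedding_smul_left (by simp [he])
  have h1 := HasCompactSupport.enorm_le_lintegral_Ici_deriv hcd hcs (x 0)
  simp only at h1
  rw [← hx] at h1
  refine h1.trans ((setLIntegral_le_lintegral _ _).trans ?_)
  have hmeas : Measurable fun y => ‖fderiv ℝ φ y‖ₑ :=
    (hφ.continuous_fderiv one_ne_zero).measurable.enorm
  rw [← hmp.lintegral_comp hmeas]
  refine lintegral_mono fun s => ?_
  have hd : HasDerivAt (fun s : ℝ => φ (s • e)) (fderiv ℝ φ (s • e) e) s := by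
    have h2 : HasDerivAt (fun s : ℝ => s • e) e s := by
      simpa using (hasDerivAt_id s).smul_const e
    exact ((hφ.differentiable one_ne_zero) (s • e)).hasFDerivAt.comp_hasDerivAt s h2
  rw [hd.deriv]
  have h3 := (fderiv ℝ φ (s • e)).le_opNorm e
  rw [show ‖e‖ = 1 by simp [he], mul_one] at h3
  exact enorm_le_iff_norm_le.2 h3

theorem exists_eLpNorm_le_fderiv {n : ℕ} (hn : 1 ≤ n) {Ω : Set (Vec n)}
    (hΩb : Bornology.IsBounded Ω) {m : ℝ} (hm : ExponentCondition n m) :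
    ∃ (C q : ℝ≥0), 1 ≤ q ∧ q ≤ 2 ∧ ∀ φ : Vec n → Vec n, ContDiff ℝ 1 φ → HasCompactSupport φ →
      tsupport φ ⊆ Ω → eLpNorm φ (ENNReal.ofReal m) (volume.restrict Ω) ≤
        C * eLpNorm (fderiv ℝ φ) q volume := by
  have hm0 : 0 < m := by linarith [hm.1]
  have hofReal : ENNReal.ofReal m = ((m.toNNReal : ℝ≥0) : ℝ≥0∞) := rfl
  have hfin : volume Ω ≠ ⊤ := hΩb.measure_lt_top.ne
  have hgns : ∀ q : ℝ≥0, 1 ≤ q → q < n → (q : ℝ)⁻¹ - (n : ℝ)⁻¹ ≤ m⁻¹ →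
      ∃ C : ℝ≥0, ∀ φ : Vec n → Vec n, ContDiff ℝ 1 φ → HasCompactSupport φ →
      tsupport φ ⊆ Ω → eLpNorm φ (ENNReal.ofReal m) (volume.restrict Ω) ≤
        C * eLpNorm (fderiv ℝ φ) q volume := by
    intro q hq hqn hqm
    refine ⟨eLpNormLESNormFDerivOfLeConst (Vec n) volume Ω q m.toNNReal, fun φ hφ hc hs => ?_⟩
    rw [eLpNorm_restrict_eq_of_support_subset ((subset_tsupport φ).trans hs), hofReal]
    refine eLpNorm_le_eLpNorm_fderiv_of_le volume hφ ((subset_tsupport φ).trans hs) hq ?_ ?_ hΩb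
    · simpa using hqn
    · simpa [Real.coe_toNNReal m hm0.le] using hqm
  rcases (show n = 1 ∨ n = 2 ∨ 3 ≤ n by omega) with rfl | rfl | h3
  · refine ⟨((volume Ω) ^ m⁻¹).toNNReal, 1, le_rfl, by norm_num, fun φ hφ hc hs => ?_⟩
    have h1 := eLpNorm_le_of_ae_enorm_bound (μ := volume.restrict Ω) (p := ENNReal.ofReal m)
      (f := φ) (C := eLpNorm (fderiv ℝ φ) 1 volume) (ae_of_all _ fun x => by
        rw [eLpNorm_one_eq_lintegral_enorm]
        exact enorm_le_lintegral_fderiv_one hφ hc x)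
    rw [Measure.restrict_apply_univ, ENNReal.toReal_ofReal hm0.le, smul_eq_mul, mul_comm] at h1
    rwa [ENNReal.coe_toNNReal (ENNReal.rpow_ne_top_of_nonneg (by positivity) hfin)]
  -- The exponent with 1/q - 1/2 = 1/m: it lies in [1,2) for 2 ≤ m < ∞, and q = 2 itself is not
  -- admissible in dimension two.
  · set q : ℝ≥0 := (2 * m / (m + 2)).toNNReal with hq
    have hqv : (q : ℝ) = 2 * m / (m + 2) := Real.coe_toNNReal _ (by positivity)
    have hq1 : 1 ≤ q := by
      rw [← NNReal.coe_le_coe, hqv, NNReal.coe_one, le_div_iff₀ (by linarith)]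
      linarith [hm.1]
    have hq2 : q < 2 := by
      rw [← NNReal.coe_lt_coe, hqv, NNReal.coe_ofNat, div_lt_iff₀ (by linarith)]
      linarith
    obtain ⟨C, hC⟩ := hgns q hq1 (by simpa using hq2) (by
      rw [hqv]
      push_cast
      apply le_of_eq
      field_simp
      ring)
    exact ⟨C, q, hq1, hq2.le, hC⟩
  · have hn3 : (3 : ℝ) ≤ n := by exact_mod_cast h3
    obtain ⟨C, hC⟩ := hgns 2 (by norm_num) (by exact_mod_cast h3) (by
      have h := hm.2 h3
      rw [le_div_iff₀ (by linarith)] at h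
      have e : ((2 : ℝ≥0) : ℝ)⁻¹ - (n : ℝ)⁻¹ = (n - 2) / (2 * n) := by
        push_cast
        field_simp
      rw [e, inv_eq_one_div, div_le_div_iff₀ (by positivity) hm0]
      linarith)
    exact ⟨C, 2, by norm_num, le_rfl, hC⟩

theorem exists_eLpNorm_le_grad {n : ℕ} (hn : 1 ≤ n) {Ω : Set (Vec n)}
    (hΩb : Bornology.IsBounded Ω) {m : ℝ} (hm : ExponentCondition n m) :
    ∃ C : ℝ≥0, ∀ φ : Vec n → Vec n, ContDiff ℝ ∞ φ → HasCompactSupport φ →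
      tsupport φ ⊆ Ω → eLpNorm φ (ENNReal.ofReal m) (volume.restrict Ω) ≤
        C * eLpNorm (grad φ) 2 (volume.restrict Ω) := by
  obtain ⟨C, q, hq1, hq2, hC⟩ := exists_eLpNorm_le_fderiv hn hΩb hm
  have hfin : volume Ω ≠ ⊤ := hΩb.measure_lt_top.ne
  set V : ℝ≥0∞ := volume Ω ^ (1 / (q : ℝ) - 1 / 2) with hV
  have hVfin : V ≠ ⊤ := by
    refine ENNReal.rpow_ne_top_of_nonneg ?_ hfin
    rw [sub_nonneg]
    exact one_div_le_one_div_of_le (by exact_mod_cast (zero_lt_one.trans_le hq1))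
      (by exact_mod_cast hq2)
  refine ⟨C * V.toNNReal, fun φ hφ hc hs => ?_⟩
  have hφ1 : ContDiff ℝ 1 φ := hφ.of_le (by exact_mod_cast le_top)
  refine (hC φ hφ1 hc hs).trans ?_
  have hsupp : Function.support (fderiv ℝ φ) ⊆ Ω := (support_fderiv_subset ℝ).trans hs
  rw [← eLpNorm_restrict_eq_of_support_subset (μ := volume) (p := q) (f := fderiv ℝ φ) hsupp]
  -- Hölder on the bounded set Ω raises q ≤ 2 to 2, at the price of a power of its volume.
  have h1 := eLpNorm_le_eLpNorm_mul_rpow_measure_univ (μ := volume.restrict Ω)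
    (f := fderiv ℝ φ) (p := q) (q := 2) (by exact_mod_cast hq2)
    (hφ1.continuous_fderiv one_ne_zero).aestronglyMeasurable
  have h2 : eLpNorm (fderiv ℝ φ) 2 (volume.restrict Ω) ≤ eLpNorm (grad φ) 2 (volume.restrict Ω) :=
    eLpNorm_mono fun x => norm_fderiv_le_norm_grad φ x
  rw [Measure.restrict_apply_univ, ENNReal.coe_toReal, ENNReal.toReal_ofNat, ← hV] at h1
  rw [ENNReal.coe_mul, ENNReal.coe_toNNReal hVfin, mul_assoc]
  refine mul_le_mul_right (h1.trans ?_) _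
  rw [mul_comm]
  exact mul_le_mul_right h2 _

/-- The Sobolev–Poincaré inequality on `H₀¹(Ω)ⁿ`. -/
theorem H10.exists_eLpNorm_fn_le {n : ℕ} (hn : 1 ≤ n) {Ω : Set (Vec n)}
    (hΩb : Bornology.IsBounded Ω) {m : ℝ} (hm : ExponentCondition n m) :
    ∃ C : ℝ, 0 ≤ C ∧ ∀ w : H10 Ω, eLpNorm (H10.fn w) (ENNReal.ofReal m) (volume.restrict Ω) ≤
      ENNReal.ofReal (C * ‖H10.gradient w‖) := by
  obtain ⟨C, hC⟩ := exists_eLpNorm_le_grad hn hΩb hm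
  refine ⟨C, C.coe_nonneg, fun w => ?_⟩
  have htest : ∀ z ∈ testPairs Ω, eLpNorm z.1 (ENNReal.ofReal m) (volume.restrict Ω) ≤
      ENNReal.ofReal (C * ‖z.2‖) := by
    rintro z ⟨φ, hφ, hc, hs, e1, e2⟩
    rw [eLpNorm_congr_ae e1, ENNReal.ofReal_mul C.coe_nonneg, ENNReal.ofReal_coe_nnreal, ofReal_norm,
      Lp.enorm_def, eLpNorm_congr_ae e2]
    exact hC φ hφ hc hs
  have hw : (w : L2 Ω (Vec n) × L2 Ω (Jac n)) ∈ closure (testPairs Ω : Set _) := w.2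
  obtain ⟨z, hz, hlim⟩ := mem_closure_iff_seq_limit.1 hw
  have hl1 : Tendsto (fun k => (z k).1) atTop (𝓝 (H10.fn w)) :=
    (continuous_fst.tendsto _).comp hlim
  have hl2 : Tendsto (fun k => ‖(z k).2‖) atTop (𝓝 ‖H10.gradient w‖) :=
    ((continuous_snd.norm).tendsto _).comp hlim
  -- Convergence holds only in L². An almost everywhere convergent subsequence and Fatou give lower
  -- semicontinuity of the L^m norm; the slack ε turns the convergent gradient norms into one
  -- eventual bound.
  obtain ⟨ns, hns, hae⟩ := (tendstoInMeasure_of_tendsto_Lp hl1).exists_seq_tendsto_ae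
  have hbound : ∀ ε : ℝ, 0 < ε → eLpNorm (H10.fn w) (ENNReal.ofReal m) (volume.restrict Ω) ≤
      ENNReal.ofReal (C * (‖H10.gradient w‖ + ε)) := by
    intro ε hε
    refine Lp.eLpNorm_le_of_ae_tendsto (u := atTop) (f := fun k => (z (ns k)).1) ?_
      (fun k => Lp.aestronglyMeasurable _) hae
    filter_upwards [(hl2.comp hns.tendsto_atTop).eventually
      (ge_mem_nhds (show ‖H10.gradient w‖ < ‖H10.gradient w‖ + ε by linarith))] with k hk
    exact (htest _ (hz _)).trans (ENNReal.ofReal_le_ofReal (mul_le_mul_of_nonneg_left hk C.coe_nonneg))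
  have hcont : Continuous fun ε : ℝ => ENNReal.ofReal (C * (‖H10.gradient w‖ + ε)) :=
    ENNReal.continuous_ofReal.comp (by fun_prop)
  have h := (hcont.tendsto 0).mono_left (nhdsWithin_le_nhds (s := Ioi 0))
  rw [add_zero] at h
  exact ge_of_tendsto h (by filter_upwards [self_mem_nhdsWithin] with ε hε using hbound ε hε)

end Sobolev

/-! ### The nonlinear damping term -/

section Flux

variable {n : ℕ}

/-- The nonlinear flux `M |v|^{m-2} v`. -/
noncomputable def flux (M : Matrix (Fin n) (Fin n) ℝ) (m : ℝ) (v : Vec n) : Vec n :=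
  Matrix.toEuclideanCLM (𝕜 := ℝ) M (‖v‖ ^ (m - 2) • v)

theorem norm_toEuclideanCLM_le {M : Matrix (Fin n) (Fin n) ℝ} {K : ℝ}
    (hM : ∀ i j, |M i j| ≤ K) (v : Vec n) :
    ‖Matrix.toEuclideanCLM (𝕜 := ℝ) M v‖ ≤ n * |K| * ‖v‖ := by
  refine le_of_sq_le_sq ?_ (by positivity)
  have hrow : ∀ i, (Matrix.toEuclideanCLM (𝕜 := ℝ) M v i) ^ 2 ≤ n * |K| ^ 2 * ‖v‖ ^ 2 := by
    intro i
    have e : Matrix.toEuclideanCLM (𝕜 := ℝ) M v i = ∑ j, M i j * v j := by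
      rw [Matrix.ofLp_toEuclideanCLM]
      rfl
    rw [e, EuclideanSpace.norm_sq_eq]
    refine (Finset.sum_mul_sq_le_sq_mul_sq _ _ _).trans ?_
    simp only [Real.norm_eq_abs, sq_abs]
    refine mul_le_mul_of_nonneg_right ?_ (Finset.sum_nonneg fun i _ => sq_nonneg _)
    calc ∑ j, M i j ^ 2 ≤ ∑ _j : Fin n, K ^ 2 := by
          refine Finset.sum_le_sum fun j _ => ?_
          exact sq_le_sq.2 ((hM i j).trans (le_abs_self K))
      _ = n * K ^ 2 := by simp
  rw [EuclideanSpace.norm_sq_eq]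
  calc ∑ i, ‖Matrix.toEuclideanCLM (𝕜 := ℝ) M v i‖ ^ 2 ≤ ∑ _i : Fin n, n * |K| ^ 2 * ‖v‖ ^ 2 := by
        refine Finset.sum_le_sum fun i _ => ?_
        rw [Real.norm_eq_abs, sq_abs]
        exact hrow i
    _ = (n * |K| * ‖v‖) ^ 2 := by
      simp only [Finset.sum_const, Finset.card_univ, Fintype.card_fin, nsmul_eq_mul]
      ring

theorem continuous_flux (M : Matrix (Fin n) (Fin n) ℝ) {m : ℝ} (hm : 2 ≤ m) :
    Continuous (flux M m) :=
  (Matrix.toEuclideanCLM (𝕜 := ℝ) M).continuous.comp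
    ((continuous_norm.rpow_const fun _ => Or.inr (by linarith)).smul continuous_id)

theorem norm_flux_le {M : Matrix (Fin n) (Fin n) ℝ} {K m : ℝ} (hm : 2 ≤ m)
    (hM : ∀ i j, |M i j| ≤ K) (v : Vec n) : ‖flux M m v‖ ≤ n * |K| * ‖v‖ ^ (m - 1) := by
  refine (norm_toEuclideanCLM_le hM _).trans (le_of_eq ?_)
  rw [norm_smul, Real.norm_of_nonneg (Real.rpow_nonneg (norm_nonneg v) _)]
  congr 1
  nth_rw 2 [← Real.rpow_one ‖v‖]
  rw [← Real.rpow_add' (norm_nonneg v) (by linarith)]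
  congr 1
  ring

theorem le_inner_flux {M : Matrix (Fin n) (Fin n) ℝ} {c m : ℝ} (hm : 2 ≤ m)
    (hM : ∀ v : Vec n, c * ‖v‖ ^ 2 ≤ inner ℝ (Matrix.toEuclideanCLM (𝕜 := ℝ) M v) v) (v : Vec n) :
    c * ‖v‖ ^ m ≤ inner ℝ (flux M m v) v := by
  rw [flux, map_smul, real_inner_smul_left]
  have e : ‖v‖ ^ m = ‖v‖ ^ (m - 2) * ‖v‖ ^ 2 := by
    rw [← Real.rpow_natCast, ← Real.rpow_add' (norm_nonneg v) (by push_cast; linarith)]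
    congr 1
    push_cast
    ring
  rw [e]
  have := mul_le_mul_of_nonneg_left (hM v) (Real.rpow_nonneg (norm_nonneg v) (m - 2))
  linarith

variable {α : Type*} [MeasurableSpace α] {μ : Measure α} {M : Matrix (Fin n) (Fin n) ℝ} {K m : ℝ}

/-- Hölder with exponents m/(m-1) and m, as the flux grows like |v|^{m-1}; n|K| bounds the operator
norm of the matrix. -/
theorem lintegral_inner_flux_le (hm : 2 ≤ m) (hM : ∀ i j, |M i j| ≤ K) {f φ : α → Vec n}
    (hf : MemLp f (ENNReal.ofReal m) μ) (hφ : MemLp φ (ENNReal.ofReal m) μ) :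
    ∫⁻ x, ‖(inner ℝ (flux M m (f x)) (φ x) : ℝ)‖ₑ ∂μ ≤ ENNReal.ofReal (n * |K|) *
      (eLpNorm f (ENNReal.ofReal m) μ ^ (m - 1) * eLpNorm φ (ENNReal.ofReal m) μ) := by
  have hm0 : 0 < m := by linarith
  have hconj : (m / (m - 1)).HolderConjugate m :=
    (Real.HolderConjugate.conjExponent (by linarith : 1 < m)).symm
  have hpt : ∀ x, ‖(inner ℝ (flux M m (f x)) (φ x) : ℝ)‖ₑ ≤
      ENNReal.ofReal (n * |K|) * (‖f x‖ₑ ^ (m - 1) * ‖φ x‖ₑ) := by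
    intro x
    have h1 : ‖(inner ℝ (flux M m (f x)) (φ x) : ℝ)‖ ≤
        n * |K| * (‖f x‖ ^ (m - 1) * ‖φ x‖) := by
      refine (norm_inner_le_norm _ _).trans ?_
      rw [← mul_assoc]
      exact mul_le_mul_of_nonneg_right (norm_flux_le hm hM _) (norm_nonneg _)
    rw [← ofReal_norm, ← ofReal_norm, ← ofReal_norm, ENNReal.ofReal_rpow_of_nonneg (norm_nonneg _)
      (by linarith), ← ENNReal.ofReal_mul (by positivity), ← ENNReal.ofReal_mul (by positivity)]
    exact ENNReal.ofReal_le_ofReal h1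
  refine (lintegral_mono hpt).trans ?_
  rw [lintegral_const_mul' _ _ ENNReal.ofReal_ne_top]
  gcongr
  have hH := ENNReal.lintegral_mul_le_Lp_mul_Lq μ hconj
    (f := fun x => ‖f x‖ₑ ^ (m - 1)) (g := fun x => ‖φ x‖ₑ)
    (hf.1.enorm.pow_const _) hφ.1.enorm
  refine hH.trans (le_of_eq ?_)
  have hne0 : ENNReal.ofReal m ≠ 0 := by simpa using hm0
  rw [eLpNorm_eq_lintegral_rpow_enorm_toReal hne0 ENNReal.ofReal_ne_top,
    eLpNorm_eq_lintegral_rpow_enorm_toReal hne0 ENNReal.ofReal_ne_top,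
    ENNReal.toReal_ofReal hm0.le, ← ENNReal.rpow_mul]
  have hm1 : m - 1 ≠ 0 := by linarith
  congr 2
  · congr 1
    ext x
    rw [← ENNReal.rpow_mul]
    congr 1
    field_simp
  · field_simp

theorem aestronglyMeasurable_inner_flux (hm : 2 ≤ m) {f φ : α → Vec n}
    (hf : AEStronglyMeasurable f μ) (hφ : AEStronglyMeasurable φ μ) :
    AEStronglyMeasurable (fun x => (inner ℝ (flux M m (f x)) (φ x) : ℝ)) μ :=
  ((continuous_flux M hm).comp_aestronglyMeasurable hf).inner hφ

theorem integrable_inner_flux (hm : 2 ≤ m) (hM : ∀ i j, |M i j| ≤ K) {f φ : α → Vec n}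
    (hf : MemLp f (ENNReal.ofReal m) μ) (hφ : MemLp φ (ENNReal.ofReal m) μ) :
    Integrable (fun x => (inner ℝ (flux M m (f x)) (φ x) : ℝ)) μ := by
  refine ⟨aestronglyMeasurable_inner_flux hm hf.1 hφ.1, ?_⟩
  refine (lintegral_inner_flux_le hm hM hf hφ).trans_lt ?_
  exact ENNReal.mul_lt_top ENNReal.ofReal_lt_top (ENNReal.mul_lt_top
    (ENNReal.rpow_lt_top_of_nonneg (by linarith) hf.2.ne) hφ.2)

theorem abs_integral_inner_flux_le (hm : 2 ≤ m) (hM : ∀ i j, |M i j| ≤ K) {f φ : α → Vec n}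
    (hf : MemLp f (ENNReal.ofReal m) μ) (hφ : MemLp φ (ENNReal.ofReal m) μ) :
    |∫ x, (inner ℝ (flux M m (f x)) (φ x) : ℝ) ∂μ| ≤ n * |K| *
      ((eLpNorm f (ENNReal.ofReal m) μ).toReal ^ (m - 1) *
        (eLpNorm φ (ENNReal.ofReal m) μ).toReal) := by
  have h := (enorm_integral_le_lintegral_enorm _).trans (lintegral_inner_flux_le hm hM hf hφ)
  rw [← ofReal_norm, Real.norm_eq_abs, ENNReal.ofReal_le_iff_le_toReal] at h
  · rwa [ENNReal.toReal_mul, ENNReal.toReal_mul, ENNReal.toReal_ofReal (by positivity),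
      ← ENNReal.toReal_rpow] at h
  · exact (ENNReal.mul_lt_top ENNReal.ofReal_lt_top (ENNReal.mul_lt_top
      (ENNReal.rpow_lt_top_of_nonneg (by linarith) hf.2.ne) hφ.2)).ne

theorem le_integral_inner_flux_self (hm : 2 ≤ m) (hM : ∀ i j, |M i j| ≤ K) {c : ℝ}
    (hMc : ∀ v : Vec n, c * ‖v‖ ^ 2 ≤ inner ℝ (Matrix.toEuclideanCLM (𝕜 := ℝ) M v) v)
    {f : α → Vec n} (hf : MemLp f (ENNReal.ofReal m) μ) :
    c * (eLpNorm f (ENNReal.ofReal m) μ).toReal ^ m ≤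
      ∫ x, (inner ℝ (flux M m (f x)) (f x) : ℝ) ∂μ := by
  have hm0 : 0 < m := by linarith
  have hne0 : ENNReal.ofReal m ≠ 0 := by simpa using hm0
  have hint := hf.integrable_norm_rpow hne0 ENNReal.ofReal_ne_top
  have e : (eLpNorm f (ENNReal.ofReal m) μ).toReal ^ m = ∫ x, ‖f x‖ ^ m ∂μ := by
    have h0 : 0 ≤ ∫ x, ‖f x‖ ^ m ∂μ := integral_nonneg fun x => by positivity
    rw [hf.eLpNorm_eq_integral_rpow_norm hne0 ENNReal.ofReal_ne_top,
      ENNReal.toReal_ofReal hm0.le, ENNReal.toReal_ofReal (Real.rpow_nonneg h0 _),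
      ← Real.rpow_mul h0, inv_mul_cancel₀ hm0.ne', Real.rpow_one]
  rw [ENNReal.toReal_ofReal hm0.le] at hint
  rw [e, ← integral_const_mul]
  exact integral_mono (hint.const_mul c) (integrable_inner_flux hm hM hf hf)
    fun x => le_inner_flux hm hMc _

end Flux

/-! ### From the weak formulation to the energy inequality -/

section WeakSolution

variable {n : ℕ} {Ω : Set (Vec n)} {A : ℝ → Matrix (Fin n) (Fin n) ℝ} {g ξ : ℝ → ℝ} {m p : ℝ}
  {u₀ : H10 Ω} {u : ℝ → H10 Ω} {ut : ℝ → Vec n → Vec n}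

/-- The trajectory of gradients, constant for negative times. -/
noncomputable def gradTraj (u : ℝ → H10 Ω) (s : ℝ) : L2 Ω (Jac n) := H10.gradient (u (max s 0))

/-- The pairing of the nonlinear flux of `ut` with a test function. -/
noncomputable def fluxPairing (Ω : Set (Vec n)) (A : ℝ → Matrix (Fin n) (Fin n) ℝ) (m : ℝ)
    (ut : ℝ → Vec n → Vec n) (s : ℝ) (φ : Vec n → Vec n) : ℝ :=
  ∫ x in Ω, inner ℝ (flux (A s) m (ut s x)) (φ x)

theorem H10.continuous_gradient : Continuous (H10.gradient : H10 Ω → L2 Ω (Jac n)) :=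
  continuous_snd.comp continuous_subtype_val

theorem gradTraj_of_nonneg {s : ℝ} (hs : 0 ≤ s) : gradTraj u s = H10.gradient (u s) := by
  rw [gradTraj, max_eq_left hs]

theorem gradTraj_of_nonpos {s : ℝ} (hs : s ≤ 0) : gradTraj u s = gradTraj u 0 := by
  rw [gradTraj, gradTraj, max_eq_right hs, max_self]

theorem continuous_clamp (hu : ContinuousOn u (Ici 0)) : Continuous fun s => u (max s 0) :=
  hu.comp_continuous (continuous_id.max continuous_const) fun s => le_max_right s 0

theorem continuous_gradTraj (hu : ContinuousOn u (Ici 0)) : Continuous (gradTraj u) :=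
  H10.continuous_gradient.comp (continuous_clamp hu)

theorem energy_eq_hilbertEnergy {t : ℝ} (ht : 0 ≤ t) :
    energy g u t = hilbertEnergy g (gradTraj u) t := by
  unfold energy hilbertEnergy memory
  rw [gradTraj_of_nonneg ht]
  congr 2
  refine intervalIntegral.integral_congr fun τ hτ => ?_
  rw [uIcc_of_le ht] at hτ
  rw [gradTraj_of_nonneg hτ.1]

theorem IsWeakSolution.fluxPairing_intervalIntegrable (hu : IsWeakSolution Ω A g m u₀ u ut)
    {φ : ℝ → H10 Ω} (hφ : ContinuousOn φ (Ici 0)) {t : ℝ} (ht : 0 ≤ t) :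
    IntervalIntegrable (fun s => fluxPairing Ω A m ut s (H10.fn (φ s))) volume 0 t :=
  hu.intervalIntegrable φ hφ t ht

theorem IsWeakSolution.continuousOn_inner (hu : IsWeakSolution Ω A g m u₀ u ut)
    (hg : IsRelaxation g) {φ : ℝ → H10 Ω} (hφ : ContinuousOn φ (Ici 0)) :
    ContinuousOn (fun s => inner ℝ (gradTraj u s - conv g (gradTraj u) s)
      (H10.gradient (φ s))) (Ici 0) := by
  have hw := continuous_gradTraj hu.continuousOn
  exact (hw.continuousOn.sub (conv_continuousOn hg.integrableOn hw
    fun s hs => gradTraj_of_nonpos hs)).inner (H10.continuous_gradient.comp_continuousOn hφ)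

theorem IsWeakSolution.integral_eq_zero (hu : IsWeakSolution Ω A g m u₀ u ut)
    (hg : IsRelaxation g) {φ : ℝ → H10 Ω} (hφ : ContinuousOn φ (Ici 0)) {t : ℝ} (ht : 0 ≤ t) :
    ∫ s in (0 : ℝ)..t, (inner ℝ (gradTraj u s - conv g (gradTraj u) s) (H10.gradient (φ s)) +
      fluxPairing Ω A m ut s (H10.fn (φ s))) = 0 := by
  rw [intervalIntegral.integral_add _ (hu.fluxPairing_intervalIntegrable hφ ht)]
  · refine Eq.trans ?_ (hu.equation φ hφ t ht)
    refine congrArg₂ (· + ·) (intervalIntegral.integral_congr fun s hs => ?_) rfl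
    rw [uIcc_of_le ht] at hs
    rw [gradTraj_of_nonneg hs.1]
    congr 2
    refine intervalIntegral.integral_congr fun τ hτ => ?_
    rw [uIcc_of_le hs.1] at hτ
    rw [gradTraj_of_nonneg hτ.1]
  · refine ContinuousOn.intervalIntegrable ((hu.continuousOn_inner hg hφ).mono ?_)
    rw [uIcc_of_le ht]
    exact Icc_subset_Ici_self

theorem IsWeakSolution.intervalIntegrable_sum (hu : IsWeakSolution Ω A g m u₀ u ut)
    (hg : IsRelaxation g) {φ : ℝ → H10 Ω} (hφ : ContinuousOn φ (Ici 0)) {t : ℝ} (ht : 0 ≤ t) :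
    IntervalIntegrable (fun s => inner ℝ (gradTraj u s - conv g (gradTraj u) s)
      (H10.gradient (φ s)) + fluxPairing Ω A m ut s (H10.fn (φ s))) volume 0 t := by
  refine IntervalIntegrable.add (ContinuousOn.intervalIntegrable
    ((hu.continuousOn_inner hg hφ).mono ?_)) (hu.fluxPairing_intervalIntegrable hφ ht)
  rw [uIcc_of_le ht]
  exact Icc_subset_Ici_self

/-- The weak equation at almost every time. -/
theorem IsWeakSolution.ae_eq_zero (hu : IsWeakSolution Ω A g m u₀ u ut)
    (hg : IsRelaxation g) {φ : ℝ → H10 Ω} (hφ : ContinuousOn φ (Ici 0)) :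
    ∀ᵐ t, 0 < t → inner ℝ (gradTraj u t - conv g (gradTraj u) t) (H10.gradient (φ t)) +
      fluxPairing Ω A m ut t (H10.fn (φ t)) = 0 := by
  -- Lebesgue differentiation of a primitive that vanishes identically. It is stated on the
  -- intervals [0,N], whose countable number keeps a common null set.
  have h : ∀ᵐ t, ∀ N : ℕ, t ∈ uIcc 0 (N : ℝ) → ∀ c ∈ uIcc 0 (N : ℝ), HasDerivAt
      (fun x => ∫ s in c..x, (inner ℝ (gradTraj u s - conv g (gradTraj u) s) (H10.gradient (φ s)) +
        fluxPairing Ω A m ut s (H10.fn (φ s))))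
      (inner ℝ (gradTraj u t - conv g (gradTraj u) t) (H10.gradient (φ t)) +
        fluxPairing Ω A m ut t (H10.fn (φ t))) t :=
    ae_all_iff.2 fun N => (hu.intervalIntegrable_sum hg hφ N.cast_nonneg).ae_hasDerivAt_integral
  filter_upwards [h] with t ht ht0
  obtain ⟨N, hN⟩ := exists_nat_ge t
  have h1 := ht N (by rw [uIcc_of_le N.cast_nonneg]; exact ⟨ht0.le, hN⟩) 0 left_mem_uIcc
  have h2 : HasDerivAt (fun x => ∫ s in (0 : ℝ)..x,
      (inner ℝ (gradTraj u s - conv g (gradTraj u) s) (H10.gradient (φ s)) +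
        fluxPairing Ω A m ut s (H10.fn (φ s)))) 0 t := by
    refine (hasDerivAt_const t (0 : ℝ)).congr_of_eventuallyEq ?_
    filter_upwards [Ioi_mem_nhds ht0] with x hx
    exact hu.integral_eq_zero hg hφ (le_of_lt hx)
  exact h1.unique h2

open Classical in
/-- The solution as a path in `L^m`, for positive times. -/
noncomputable def IsWeakSolution.lpPath (hu : IsWeakSolution Ω A g m u₀ u ut) (s : ℝ) :
    Lp (Vec n) (ENNReal.ofReal m) (volume.restrict Ω) :=
  if h : 0 < s then (hu.memLp s h).toLp else 0

open Classical in
/-- The time derivative as a path in `L^m`, for positive times. -/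
noncomputable def IsWeakSolution.lpDeriv (hu : IsWeakSolution Ω A g m u₀ u ut) (s : ℝ) :
    Lp (Vec n) (ENNReal.ofReal m) (volume.restrict Ω) :=
  if h : 0 < s then (hu.memLp_deriv s h).toLp else 0

theorem IsWeakSolution.lpPath_coeFn (hu : IsWeakSolution Ω A g m u₀ u ut) {s : ℝ} (hs : 0 < s) :
    hu.lpPath s =ᵐ[volume.restrict Ω] H10.fn (u s) := by
  rw [lpPath, dif_pos hs]
  exact MemLp.coeFn_toLp _

theorem IsWeakSolution.lpDeriv_coeFn (hu : IsWeakSolution Ω A g m u₀ u ut) {s : ℝ} (hs : 0 < s) :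
    hu.lpDeriv s =ᵐ[volume.restrict Ω] ut s := by
  rw [lpDeriv, dif_pos hs]
  exact MemLp.coeFn_toLp _

theorem IsWeakSolution.norm_lpDeriv (hu : IsWeakSolution Ω A g m u₀ u ut) {s : ℝ} (hs : 0 < s) :
    ‖hu.lpDeriv s‖ = (eLpNorm (ut s) (ENNReal.ofReal m) (volume.restrict Ω)).toReal := by
  rw [Lp.norm_def, eLpNorm_congr_ae (hu.lpDeriv_coeFn hs)]

theorem IsWeakSolution.hasDerivAt_lpPath [Fact (1 ≤ ENNReal.ofReal m)]
    (hu : IsWeakSolution Ω A g m u₀ u ut) {s : ℝ} (hs : 0 < s) :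
    HasDerivAt hu.lpPath (hu.lpDeriv s) s := by
  rw [hasDerivAt_iff_tendsto_slope_zero, tendsto_iff_norm_sub_tendsto_zero]
  have h := (ENNReal.tendsto_toReal (by simp)).comp (hu.hasDeriv s hs)
  simp only [ENNReal.toReal_zero] at h
  refine h.congr' ?_
  have hev : ∀ᶠ r : ℝ in 𝓝[≠] 0, 0 < s + r :=
    nhdsWithin_le_nhds ((continuous_const.add continuous_id).continuousAt.eventually
      (lt_mem_nhds (by simpa using hs)))
  filter_upwards [hev] with r hr
  rw [Function.comp_apply, Lp.norm_def]
  congr 1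
  refine eLpNorm_congr_ae ?_
  filter_upwards [Lp.coeFn_sub (r⁻¹ • (hu.lpPath (s + r) - hu.lpPath s)) (hu.lpDeriv s),
    Lp.coeFn_smul r⁻¹ (hu.lpPath (s + r) - hu.lpPath s),
    Lp.coeFn_sub (hu.lpPath (s + r)) (hu.lpPath s), hu.lpPath_coeFn hr, hu.lpPath_coeFn hs,
    hu.lpDeriv_coeFn hs] with x h1 h2 h3 h4 h5 h6
  rw [h1, Pi.sub_apply, h2, Pi.smul_apply, h3, Pi.sub_apply, h4, h5, h6]

theorem IsWeakSolution.continuousOn_lpDeriv [Fact (1 ≤ ENNReal.ofReal m)]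
    (hu : IsWeakSolution Ω A g m u₀ u ut) : ContinuousOn hu.lpDeriv (Ioi 0) := by
  intro s hs
  refine ContinuousAt.continuousWithinAt ?_
  rw [ContinuousAt, tendsto_iff_norm_sub_tendsto_zero]
  have h := (ENNReal.tendsto_toReal (by simp)).comp (hu.continuous_deriv s hs)
  simp only [ENNReal.toReal_zero] at h
  refine h.congr' ?_
  filter_upwards [Ioi_mem_nhds (mem_Ioi.1 hs)] with r hr
  rw [Function.comp_apply, Lp.norm_def]
  congr 1
  refine eLpNorm_congr_ae ?_
  filter_upwards [Lp.coeFn_sub (hu.lpDeriv r) (hu.lpDeriv s), hu.lpDeriv_coeFn hr,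
    hu.lpDeriv_coeFn hs] with x h1 h2 h3
  rw [h1, Pi.sub_apply, h2, h3]

/-- Uniform convergence of symmetric difference quotients of a `C¹` path on compact intervals. -/
theorem eventually_symmDiff_le {X : Type*} [NormedAddCommGroup X] [NormedSpace ℝ X] {U V : ℝ → X}
    (hU : ∀ s, 0 < s → HasDerivAt U (V s) s) (hV : ContinuousOn V (Ioi 0)) {t₁ t₂ ε : ℝ}
    (ht₁ : 0 < t₁) (hε : 0 < ε) : ∀ᶠ h in 𝓝[>] (0 : ℝ), ∀ s ∈ Icc t₁ t₂,
      ‖U (s + h) - U (s - h) - (2 * h) • V s‖ ≤ 2 * h * ε := by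
  have hcomp : UniformContinuousOn V (Icc (t₁ / 2) (t₂ + 1)) :=
    isCompact_Icc.uniformContinuousOn_of_continuous
      (hV.mono fun x hx => lt_of_lt_of_le (by linarith) hx.1)
  obtain ⟨δ, hδ, hVδ⟩ := Metric.uniformContinuousOn_iff.1 hcomp ε hε
  have hev : ∀ᶠ h in 𝓝[>] (0 : ℝ), h ∈ Ioo 0 (min δ (min (t₁ / 2) 1)) :=
    Ioo_mem_nhdsGT (by positivity)
  filter_upwards [hev] with h hh s hs
  have hh0 := hh.1
  have h1 : h < δ := hh.2.trans_le (min_le_left _ _)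
  have h2 : h < t₁ / 2 := hh.2.trans_le ((min_le_right _ _).trans (min_le_left _ _))
  have h3 : h < 1 := hh.2.trans_le ((min_le_right _ _).trans (min_le_right _ _))
  have hmv := Convex.norm_image_sub_le_of_norm_hasDerivWithin_le (C := ε)
    (f := fun σ => U σ - (σ - s) • V s) (f' := fun σ => V σ - V s) (s := Icc (s - h) (s + h))
    (x := s - h) (y := s + h) (fun σ hσ => ?_) (fun σ hσ => ?_) (convex_Icc _ _)
    ⟨le_rfl, by linarith⟩ ⟨by linarith, le_rfl⟩
  · have e1 : U (s + h) - (s + h - s) • V s - (U (s - h) - (s - h - s) • V s) =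
        U (s + h) - U (s - h) - (2 * h) • V s := by
      rw [two_mul, add_smul, add_sub_cancel_left, show s - h - s = -h by ring, neg_smul]
      abel
    rw [e1, show s + h - (s - h) = 2 * h by ring, Real.norm_of_nonneg (by linarith)] at hmv
    linarith
  · have hσ0 : 0 < σ := by linarith [hσ.1, hs.1]
    have hd := ((hasDerivAt_id σ).sub_const s).smul_const (V s)
    rw [one_smul] at hd
    exact ((hU σ hσ0).sub hd).hasDerivWithinAt
  · have hd : dist σ s < δ := by
      rw [Real.dist_eq, abs_lt]
      constructor <;> linarith [hσ.1, hσ.2]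
    have h4 := hVδ σ ⟨by linarith [hσ.1, hs.1], by linarith [hσ.2, hs.2]⟩ s
      ⟨by linarith [hs.1], by linarith [hs.2]⟩ hd
    rw [dist_eq_norm] at h4
    exact h4.le

/-- The symmetric difference of u equals 2h u_t plus a remainder. Coercivity bounds the pairing with
2h u_t from below, Hölder bounds the pairing with the remainder, which `eventually_symmDiff_le`
makes o(h). -/
theorem IsWeakSolution.le_fluxPairing_symmDiff [Fact (1 ≤ ENNReal.ofReal m)]
    (hu : IsWeakSolution Ω A g m u₀ u ut) (hm : 2 ≤ m) {c K : ℝ} {s h : ℝ} (hh : 0 < h) (hs : h < s)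
    (hK : ∀ i j, |A s i j| ≤ K)
    (hc : ∀ v : Vec n, c * ‖v‖ ^ 2 ≤ inner ℝ (Matrix.toEuclideanCLM (𝕜 := ℝ) (A s) v) v) :
    2 * h * (c * ‖hu.lpDeriv s‖ ^ m) - n * |K| * (‖hu.lpDeriv s‖ ^ (m - 1) *
        ‖hu.lpPath (s + h) - hu.lpPath (s - h) - (2 * h) • hu.lpDeriv s‖) ≤
      fluxPairing Ω A m ut s (H10.fn (u (max (s + h) 0) - u (max (s - h) 0))) := by
  have hs0 : 0 < s := hh.trans hs
  have hp : 0 < s + h := by linarith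
  have hq : 0 < s - h := by linarith
  set R := hu.lpPath (s + h) - hu.lpPath (s - h) - (2 * h) • hu.lpDeriv s with hR
  have hut := hu.memLp_deriv s hs0
  have hRm : MemLp R (ENNReal.ofReal m) (volume.restrict Ω) := Lp.memLp R
  have hae : H10.fn (u (max (s + h) 0) - u (max (s - h) 0)) =ᵐ[volume.restrict Ω]
      fun x => (2 * h) • ut s x + R x := by
    rw [max_eq_left hp.le, max_eq_left hq.le]
    have e : H10.fn (u (s + h) - u (s - h)) = H10.fn (u (s + h)) - H10.fn (u (s - h)) := rfl
    rw [e]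
    filter_upwards [Lp.coeFn_sub (H10.fn (u (s + h))) (H10.fn (u (s - h))),
      Lp.coeFn_sub (hu.lpPath (s + h) - hu.lpPath (s - h)) ((2 * h) • hu.lpDeriv s),
      Lp.coeFn_smul (2 * h) (hu.lpDeriv s), Lp.coeFn_sub (hu.lpPath (s + h)) (hu.lpPath (s - h)),
      hu.lpPath_coeFn hp, hu.lpPath_coeFn hq, hu.lpDeriv_coeFn hs0] with x h1 h2 h3 h4 h5 h6 h7
    rw [h1, hR, h2, Pi.sub_apply, Pi.sub_apply, h3, Pi.smul_apply, h4, Pi.sub_apply, h5, h6, h7]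
    abel
  have e : fluxPairing Ω A m ut s (H10.fn (u (max (s + h) 0) - u (max (s - h) 0))) =
      2 * h * (∫ x in Ω, inner ℝ (flux (A s) m (ut s x)) (ut s x)) +
        ∫ x in Ω, inner ℝ (flux (A s) m (ut s x)) (R x) := by
    rw [fluxPairing, ← integral_const_mul,
      ← integral_add ((integrable_inner_flux hm hK hut hut).const_mul _)
        (integrable_inner_flux hm hK hut hRm)]
    refine integral_congr_ae (hae.mono fun x hx => ?_)
    simp only
    rw [hx, inner_add_right, real_inner_smul_right]
  have h1 := le_integral_inner_flux_self hm hK hc hut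
  have h2 := abs_integral_inner_flux_le hm hK hut hRm
  rw [← hu.norm_lpDeriv hs0] at h1 h2
  rw [← Lp.norm_def] at h2
  have h3 := neg_abs_le (∫ x in Ω, (inner ℝ (flux (A s) m (ut s x)) (R x) : ℝ))
  have h4 := mul_le_mul_of_nonneg_left h1 (by linarith : 0 ≤ 2 * h)
  rw [e]
  linarith

/-- The energy inequality. -/
theorem IsWeakSolution.isDissipative [Fact (1 ≤ ENNReal.ofReal m)]
    (hu : IsWeakSolution Ω A g m u₀ u ut) (hm : 2 ≤ m)
    (hg : IsRelaxation g) (hp : DecayCondition g ξ p) {c K : ℝ} (hc0 : 0 ≤ c)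
    (hK : ∀ t, 0 ≤ t → ∀ i j, |A t i j| ≤ K)
    (hc : ∀ t, 0 ≤ t → ∀ v : Vec n,
      c * ‖v‖ ^ 2 ≤ inner ℝ (Matrix.toEuclideanCLM (𝕜 := ℝ) (A t) v) v) :
    IsDissipative g (gradTraj u) fun t => c * ‖hu.lpDeriv t‖ ^ m := by
  have hw := continuous_gradTraj hu.continuousOn
  have hneg : ∀ s ≤ 0, gradTraj u s = gradTraj u 0 := fun s hs => gradTraj_of_nonpos hs
  have hN : ContinuousOn (fun t => ‖hu.lpDeriv t‖) (Ioi 0) := hu.continuousOn_lpDeriv.norm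
  have hP : ContinuousOn (fun t => c * ‖hu.lpDeriv t‖ ^ m) (Ioi 0) :=
    continuousOn_const.mul (hN.rpow_const fun _ _ => Or.inr (by linarith))
  refine ⟨hw, hneg, fun t _ => by positivity, hP, fun t₁ t₂ ht₁ h12 => ?_⟩
  have hsub : uIcc t₁ t₂ ⊆ Ioi 0 := by
    rw [uIcc_of_le h12]; exact fun x hx => ht₁.trans_le hx.1
  have hQ : ContinuousOn (fun t => n * |K| * ‖hu.lpDeriv t‖ ^ (m - 1)) (Ioi 0) :=
    continuousOn_const.mul (hN.rpow_const fun _ _ => Or.inr (by linarith))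
  have iP := (hP.mono hsub).intervalIntegrable (μ := volume)
  have iQ := (hQ.mono hsub).intervalIntegrable (μ := volume)
  have ht₂ : 0 ≤ t₂ := ht₁.le.trans h12
  have hk := convDeriv_continuous hg hp hw hneg
  have hlim := tendsto_integral_symmDiff hw hk t₁ t₂
  rw [← conv_eq_integral_convDeriv hg hp hw hneg ht₂,
    ← conv_eq_integral_convDeriv hg hp hw hneg ht₁.le] at hlim
  have hsubE := hilbertEnergy_sub hg hp hw hneg ht₁.le h12
  set L := (1 / 2 * ‖gradTraj u t₂‖ ^ 2 - inner ℝ (conv g (gradTraj u) t₂) (gradTraj u t₂)) -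
        (1 / 2 * ‖gradTraj u t₁‖ ^ 2 - inner ℝ (conv g (gradTraj u) t₁) (gradTraj u t₁)) +
          ∫ s in t₁..t₂, inner ℝ (convDeriv g (gradTraj u) s) (gradTraj u s) with hL
  -- L is the limit of the elliptic part of the equation tested with (u(s+h)-u(s-h))/2h, so it
  -- equals minus the limit of the damping part; ε measures the remainder in the difference
  -- quotient.
  have hLε : ∀ ε, 0 < ε → L ≤ -(∫ s in t₁..t₂, c * ‖hu.lpDeriv s‖ ^ m) +
      ε * ∫ s in t₁..t₂, n * |K| * ‖hu.lpDeriv s‖ ^ (m - 1) := by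
    intro ε hε
    refine le_of_tendsto hlim ?_
    have hunif := eventually_symmDiff_le (U := hu.lpPath) (V := hu.lpDeriv)
      (fun s hs => hu.hasDerivAt_lpPath hs) hu.continuousOn_lpDeriv (t₂ := t₂) ht₁ hε
    filter_upwards [hunif, Ioo_mem_nhdsGT ht₁] with h hh hh1
    have hh0 := hh1.1
    -- Clamping at 0 gives a test function on all of [0,∞); as h < t₁, it is inactive on [t₁,t₂].
    -- The equation there is the difference of those on [0,t₂] and [0,t₁].
    have hφ : ContinuousOn (fun s => u (max (s + h) 0) - u (max (s - h) 0)) (Ici 0) := by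
      have hcl := continuous_clamp hu.continuousOn
      exact ((hcl.comp (continuous_id.add continuous_const)).sub
        (hcl.comp (continuous_id.sub continuous_const))).continuousOn
    set B : ℝ → ℝ := fun s =>
      fluxPairing Ω A m ut s (H10.fn (u (max (s + h) 0) - u (max (s - h) 0))) with hB
    have iB : ∀ a b, 0 ≤ a → 0 ≤ b → IntervalIntegrable B volume a b := fun a b ha hb =>
      (hu.fluxPairing_intervalIntegrable hφ ha).symm.trans
        (hu.fluxPairing_intervalIntegrable hφ hb)
    have hz : (∫ s in t₁..t₂, inner ℝ (gradTraj u s - conv g (gradTraj u) s)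
        (gradTraj u (s + h) - gradTraj u (s - h))) + ∫ s in t₁..t₂, B s = 0 := by
      rw [← intervalIntegral.integral_add _ (iB _ _ ht₁.le ht₂)]
      · have h1 := hu.integral_eq_zero hg hφ ht₂
        have h2 := hu.integral_eq_zero hg hφ ht₁.le
        have h3 := intervalIntegral.integral_interval_sub_left
          (hu.intervalIntegrable_sum hg hφ ht₂) (hu.intervalIntegrable_sum hg hφ ht₁.le)
        rw [h1, h2, sub_zero] at h3
        exact h3.symm
      · exact ContinuousOn.intervalIntegrable
          ((hu.continuousOn_inner hg hφ).mono (hsub.trans Ioi_subset_Ici_self))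
    have hBle : ∫ s in t₁..t₂, (2 * h) * (c * ‖hu.lpDeriv s‖ ^ m -
        ε * (n * |K| * ‖hu.lpDeriv s‖ ^ (m - 1))) ≤ ∫ s in t₁..t₂, B s := by
      refine intervalIntegral.integral_mono_on h12 ((iP.sub (iQ.const_mul ε)).const_mul _)
        (iB _ _ ht₁.le ht₂) fun s hs => ?_
      have hs0 : 0 < s := ht₁.trans_le hs.1
      refine le_trans ?_ (hu.le_fluxPairing_symmDiff hm hh0 (hh1.2.trans_le hs.1)
        (hK s hs0.le) (hc s hs0.le))
      have h4 := mul_le_mul_of_nonneg_left (hh s hs)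
        (by positivity : 0 ≤ n * |K| * ‖hu.lpDeriv s‖ ^ (m - 1))
      linarith
    rw [intervalIntegral.integral_const_mul, intervalIntegral.integral_sub iP (iQ.const_mul ε),
      intervalIntegral.integral_const_mul ε] at hBle
    have hcongr : ∫ s in t₁..t₂, inner ℝ (gradTraj u s - ∫ r in (0 : ℝ)..s,
          convDeriv g (gradTraj u) r) (gradTraj u (s + h) - gradTraj u (s - h)) =
        ∫ s in t₁..t₂, inner ℝ (gradTraj u s - conv g (gradTraj u) s)
          (gradTraj u (s + h) - gradTraj u (s - h)) := by
      refine intervalIntegral.integral_congr fun s hs => ?_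
      rw [conv_eq_integral_convDeriv hg hp hw hneg (le_of_lt (hsub hs))]
    rw [hcongr, inv_mul_le_iff₀ (by positivity)]
    linarith
  have hLP : L ≤ -∫ s in t₁..t₂, c * ‖hu.lpDeriv s‖ ^ m := by
    set J := ∫ s in t₁..t₂, n * |K| * ‖hu.lpDeriv s‖ ^ (m - 1)
    have hcont : Continuous fun ε : ℝ => -(∫ s in t₁..t₂, c * ‖hu.lpDeriv s‖ ^ m) + ε * J := by
      fun_prop
    have h := (hcont.tendsto 0).mono_left (nhdsWithin_le_nhds (s := Ioi 0))
    rw [zero_mul, add_zero] at h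
    exact ge_of_tendsto h (by filter_upwards [self_mem_nhdsWithin] with ε hε using hLε ε hε)
  have hmem : ContinuousOn (memory (deriv g) (gradTraj u)) (uIcc t₁ t₂) :=
    (memory_continuousOn (hp.integrableOn_deriv hg) hw hneg).mono
      (hsub.trans Ioi_subset_Ici_self)
  have iM : IntervalIntegrable (fun s => 1 / 2 * memory (deriv g) (gradTraj u) s) volume t₁ t₂ :=
    hmem.intervalIntegrable.const_mul _
  have hdrop : ∫ s in t₁..t₂, (1 / 2 * memory (deriv g) (gradTraj u) s -
      1 / 2 * (g s * ‖gradTraj u s‖ ^ 2)) ≤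
      ∫ s in t₁..t₂, 1 / 2 * memory (deriv g) (gradTraj u) s := by
    refine intervalIntegral.integral_mono_on h12 (iM.sub (ContinuousOn.intervalIntegrable
      (continuousOn_const.mul ((hg.continuousOn.mono (hsub.trans Ioi_subset_Ici_self)).mul
        (hw.norm.pow 2).continuousOn)))) iM fun s hs => ?_
    have := mul_nonneg (hg.nonneg s (ht₁.le.trans hs.1)) (sq_nonneg ‖gradTraj u s‖)
    linarith
  rw [intervalIntegral.integral_sub iP iM]
  linarith

end WeakSolution

/-! ### Energy bounded by dissipation plus memory -/

section Stabilization

/-- A Young inequality, by comparing N with dx. The a priori bound x ≤ W turns the natural power x^m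
into x², so that the term can be absorbed by ‖∇u‖² although m may exceed 2. -/
theorem rpow_mul_le_of_le {m d N x W : ℝ} (hm : 2 ≤ m) (hd : 0 < d) (hd1 : d ≤ 1) (hN : 0 ≤ N)
    (hx : 0 ≤ x) (hxW : x ≤ W) :
    N ^ (m - 1) * x ≤ d * W ^ (m - 2) * x ^ 2 + d⁻¹ * N ^ m := by
  have hW : 0 ≤ W := hx.trans hxW
  rcases le_total N (d * x) with h | h
  · have h1 : N ^ (m - 1) ≤ d ^ (m - 1) * x ^ (m - 1) := by
      rw [← Real.mul_rpow hd.le hx]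
      exact Real.rpow_le_rpow hN h (by linarith)
    have h2 : d ^ (m - 1) ≤ d := by
      conv_rhs => rw [← Real.rpow_one d]
      exact Real.rpow_le_rpow_of_exponent_ge hd hd1 (by linarith)
    have h3 : x ^ (m - 1) = x ^ (m - 2) * x := by
      conv_rhs => rw [← Real.rpow_one x, ← Real.rpow_mul hx, one_mul]
      rw [← Real.rpow_add' hx (by linarith)]
      congr 1
      ring
    have h4 : x ^ (m - 2) ≤ W ^ (m - 2) := Real.rpow_le_rpow hx hxW (by linarith)
    have h5 : 0 ≤ d⁻¹ * N ^ m := by positivity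
    calc N ^ (m - 1) * x ≤ d ^ (m - 1) * x ^ (m - 1) * x := mul_le_mul_of_nonneg_right h1 hx
      _ ≤ d * (W ^ (m - 2) * x) * x := by rw [h3]; gcongr
      _ ≤ _ := by linarith
  · have h1 : x ≤ d⁻¹ * N := by rwa [le_inv_mul_iff₀ hd]
    have h2 : N ^ m = N ^ (m - 1) * N := by
      conv_rhs => rw [← Real.rpow_one N, ← Real.rpow_mul hN, one_mul]
      rw [← Real.rpow_add' hN (by linarith)]
      congr 1
      ring
    have h3 := mul_le_mul_of_nonneg_left h1 (Real.rpow_nonneg hN (m - 1))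
    have h4 : 0 ≤ d * W ^ (m - 2) * x ^ 2 := by positivity
    rw [h2]
    linarith

/-- Write w(τ) = w(t) - (w(t) - w(τ)) and apply Young with parameter l to the cross term. -/
theorem inner_conv_le {H : Type*} [NormedAddCommGroup H] [InnerProductSpace ℝ H] [CompleteSpace H]
    {g : ℝ → ℝ} (hg : IsRelaxation g) {w : ℝ → H} (hw : Continuous w) {l t : ℝ} (hl : 0 < l)
    (ht : 0 ≤ t) : inner ℝ (conv g w t) (w t) ≤
      (∫ s in (0 : ℝ)..t, g s) * ((1 + l / 2) * ‖w t‖ ^ 2) + 1 / (2 * l) * memory g w t := by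
  have i1 := conv_intervalIntegrable hg.integrableOn hw ht
  have i2 := (intervalIntegrable_comp_sub hg.integrableOn ht).mul_const ((1 + l / 2) * ‖w t‖ ^ 2)
  have i3 := (memory_intervalIntegrable hg.integrableOn hw ht).const_mul (1 / (2 * l))
  have i1' : IntervalIntegrable (fun τ => inner ℝ (w t) (g (t - τ) • w τ)) volume 0 t := by
    rw [intervalIntegrable_iff] at i1 ⊢
    exact i1.const_inner (w t)
  have e1 : ∫ τ in (0 : ℝ)..t, inner ℝ (w t) (g (t - τ) • w τ) =
      inner ℝ (conv g w t) (w t) := by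
    rw [real_inner_comm, conv, intervalIntegral.integral_of_le ht,
      intervalIntegral.integral_of_le ht]
    exact integral_inner i1.1 (w t)
  have e2 : ∫ τ in (0 : ℝ)..t, g (t - τ) * ((1 + l / 2) * ‖w t‖ ^ 2) =
      (∫ σ in (0 : ℝ)..t, g σ) * ((1 + l / 2) * ‖w t‖ ^ 2) := by
    rw [intervalIntegral.integral_mul_const, intervalIntegral.integral_comp_sub_left g t]
    simp
  have e3 : ∫ τ in (0 : ℝ)..t, 1 / (2 * l) * (g (t - τ) * ‖w t - w τ‖ ^ 2) =
      1 / (2 * l) * memory g w t := intervalIntegral.integral_const_mul _ _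
  rw [← e1, ← e2, ← e3, ← intervalIntegral.integral_add i2 i3]
  refine intervalIntegral.integral_mono_on ht i1' (i2.add i3) fun τ hτ => ?_
  have hgn := hg.nonneg (t - τ) (by linarith [hτ.2])
  rw [real_inner_smul_right]
  have h1 : inner ℝ (w t) (w τ) ≤ (1 + l / 2) * ‖w t‖ ^ 2 + 1 / (2 * l) * ‖w t - w τ‖ ^ 2 := by
    have h2 : inner ℝ (w t) (w τ) = ‖w t‖ ^ 2 - inner ℝ (w t) (w t - w τ) := by
      rw [inner_sub_right, real_inner_self_eq_norm_sq]
      ring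
    have h3 := (abs_le.1 (abs_real_inner_le_norm (w t) (w t - w τ))).1
    have h4 : ‖w t‖ * ‖w t - w τ‖ ≤ l / 2 * ‖w t‖ ^ 2 + 1 / (2 * l) * ‖w t - w τ‖ ^ 2 := by
      have h5 : l / 2 * ‖w t‖ ^ 2 + 1 / (2 * l) * ‖w t - w τ‖ ^ 2 - ‖w t‖ * ‖w t - w τ‖ =
          (l * ‖w t‖ - ‖w t - w τ‖) ^ 2 / (2 * l) := by
        field_simp
        ring
      have : 0 ≤ (l * ‖w t‖ - ‖w t - w τ‖) ^ 2 / (2 * l) := by positivity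
      linarith
    linarith
  have h6 := mul_le_mul_of_nonneg_left h1 hgn
  linarith

variable {n : ℕ} {Ω : Set (Vec n)} {A : ℝ → Matrix (Fin n) (Fin n) ℝ} {g ξ : ℝ → ℝ} {m p : ℝ}
  {u₀ : H10 Ω} {u : ℝ → H10 Ω} {ut : ℝ → Vec n → Vec n}

/-- The equation tested with u reads ‖w‖² - ⟨g * w, w⟩ = -∫A|u_t|^{m-2}u_t·u. With l = 1 - ∫g, the
left side is at least (l/2)‖w‖² minus a multiple of the memory; the right side is at most (l/4)‖w‖²
plus a multiple of P. -/
theorem IsWeakSolution.exists_stabilization [Fact (1 ≤ ENNReal.ofReal m)] (hn : 1 ≤ n)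
    (hΩb : Bornology.IsBounded Ω) (hu : IsWeakSolution Ω A g m u₀ u ut)
    (hm : ExponentCondition n m) (hg : IsRelaxation g) (hp : DecayCondition g ξ p) {c K : ℝ}
    (hc0 : 0 < c) (hK : ∀ t, 0 ≤ t → ∀ i j, |A t i j| ≤ K)
    (hdis : IsDissipative g (gradTraj u) fun t => c * ‖hu.lpDeriv t‖ ^ m) :
    ∃ C₀, 0 < C₀ ∧ ∀ᵐ t, 0 < t → hilbertEnergy g (gradTraj u) t ≤
      C₀ * (c * ‖hu.lpDeriv t‖ ^ m + memory g (gradTraj u) t) := by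
  obtain ⟨S, hS0, hS⟩ := H10.exists_eLpNorm_fn_le hn hΩb hm
  set w := gradTraj u with hw
  set l := 1 - ∫ s in Ioi (0 : ℝ), g s with hl
  have hl0 : 0 < l := hg.integral_lt
  set E₀ := hilbertEnergy g w 0 with hE₀
  have hE₀0 : 0 ≤ E₀ := hilbertEnergy_nonneg hg le_rfl
  set W := Real.sqrt (2 * E₀ / l) with hW
  set R := n * |K| * S with hR
  have hR0 : 0 ≤ R := by positivity
  -- Small enough that the quadratic term from Young's inequality is at most (l/4)x²; the 1 in the
  -- denominator covers the case R W^{m-2} = 0.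
  set d := min 1 (l / (4 * (R * W ^ (m - 2) + 1))) with hd
  have hWm : 0 ≤ W ^ (m - 2) := Real.rpow_nonneg (Real.sqrt_nonneg _) _
  have hd0 : 0 < d := by positivity
  have hd1 : d ≤ 1 := min_le_left _ _
  have hdl : R * (d * W ^ (m - 2)) ≤ l / 4 := by
    have h1 : d * (4 * (R * W ^ (m - 2) + 1)) ≤ l := by
      rw [← le_div_iff₀ (by positivity)]
      exact min_le_right _ _
    linarith
  refine ⟨1 / 2 + 1 / l ^ 2 + 2 * R * d⁻¹ / (l * c), by positivity, ?_⟩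
  filter_upwards [hu.ae_eq_zero hg hu.continuousOn] with t ht ht0
  have hG := hg.integral_le ht0.le
  have hmem := memory_nonneg (w := w) hg.nonneg ht0.le
  set N := ‖hu.lpDeriv t‖ with hN
  set x := ‖w t‖ with hx
  have hxW : x ≤ W := by
    refine Real.le_sqrt_of_sq_le ?_
    have h1 := norm_sq_le_hilbertEnergy (w := w) hg ht0.le
    have h2 := hdis.antitoneOn hg hp self_mem_Ici ht0.le ht0.le
    rw [le_div_iff₀ hl0]
    linarith
  have hB : |fluxPairing Ω A m ut t (H10.fn (u t))| ≤ R * (N ^ (m - 1) * x) := by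
    refine (abs_integral_inner_flux_le hm.1 (hK t ht0.le) (hu.memLp_deriv t ht0)
      (hu.memLp t ht0)).trans ?_
    rw [← hu.norm_lpDeriv ht0]
    have h1 : (eLpNorm (H10.fn (u t)) (ENNReal.ofReal m) (volume.restrict Ω)).toReal ≤ S * x := by
      refine ENNReal.toReal_le_of_le_ofReal (by positivity) ?_
      rw [hx, hw, gradTraj_of_nonneg ht0.le]
      exact hS (u t)
    have h2 : N ^ (m - 1) * (eLpNorm (H10.fn (u t)) (ENNReal.ofReal m)
        (volume.restrict Ω)).toReal ≤ N ^ (m - 1) * (S * x) :=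
      mul_le_mul_of_nonneg_left h1 (by positivity)
    have h3 := mul_le_mul_of_nonneg_left h2 (by positivity : 0 ≤ n * |K|)
    rw [hR]
    linarith
  have hyoung := rpow_mul_le_of_le (x := x) hm.1 hd0 hd1 (norm_nonneg (hu.lpDeriv t))
    (norm_nonneg _) hxW
  have hconv := inner_conv_le hg hdis.continuous hl0 ht0.le
  have hid : x ^ 2 - inner ℝ (conv g w t) (w t) = -fluxPairing Ω A m ut t (H10.fn (u t)) := by
    have h1 := ht ht0
    rw [← gradTraj_of_nonneg ht0.le, inner_sub_left, real_inner_self_eq_norm_sq] at h1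
    linarith
  have hnegB := neg_abs_le (fluxPairing Ω A m ut t (H10.fn (u t)))
  have hG1 : (∫ s in (0 : ℝ)..t, g s) * ((1 + l / 2) * x ^ 2) ≤
      (1 - l) * ((1 + l / 2) * x ^ 2) :=
    mul_le_mul_of_nonneg_right (by linarith) (by positivity)
  have hRy := mul_le_mul_of_nonneg_left hyoung hR0
  have hdx := mul_le_mul_of_nonneg_right hdl (sq_nonneg x)
  have hmain : l / 4 * x ^ 2 ≤ R * d⁻¹ * N ^ m + 1 / (2 * l) * memory g w t := by
    have h1 : 0 ≤ l * (l / 2) * x ^ 2 := by positivity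
    have h2 : x ^ 2 - inner ℝ (conv g w t) (w t) ≤ R * (N ^ (m - 1) * x) := by
      rw [hid]; linarith
    have h3 : (1 - l) * ((1 + l / 2) * x ^ 2) = x ^ 2 - l / 2 * x ^ 2 - l * (l / 2) * x ^ 2 := by
      ring
    linarith
  have hx2 : x ^ 2 ≤ 4 / l * (R * d⁻¹ * N ^ m + 1 / (2 * l) * memory g w t) := by
    rw [div_mul_eq_mul_div, le_div_iff₀ hl0]
    linarith
  have hE := hilbertEnergy_le (w := w) hg ht0.le
  have e1 : (1 / 2 + 1 / l ^ 2 + 2 * R * d⁻¹ / (l * c)) * (c * N ^ m + memory g w t) =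
      1 / 2 * memory g w t + 1 / 2 * (4 / l * (R * d⁻¹ * N ^ m + 1 / (2 * l) * memory g w t)) +
      ((1 / 2 + 1 / l ^ 2) * (c * N ^ m) + 2 * R * d⁻¹ / (l * c) * memory g w t) := by
    field_simp
    ring
  have h5 : 0 ≤ (1 / 2 + 1 / l ^ 2) * (c * N ^ m) + 2 * R * d⁻¹ / (l * c) * memory g w t := by
    positivity
  rw [e1]
  linarith

end Stabilization

/-! ### Polynomial kernels: admissibility and the lower bound -/

section PolynomialKernel

variable {H : Type*} [NormedAddCommGroup H] {g : ℝ → ℝ} {a ν : ℝ}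

/-- Near τ = 0 one has ‖w(τ)‖² ≥ b with b = ‖w(0)‖²/4. If ‖w(t)‖² ≥ b/4, the elastic part of the
energy is bounded below. Otherwise ‖w(t)-w(τ)‖² ≥ b/4 for all these τ, and since g(t-τ) ≥ g(t) the
memory is at least a multiple of g(t). The equation plays no role. -/
theorem exists_le_hilbertEnergy_of_polynomial (hg : IsRelaxation g) (ha : 0 < a) (hν : 0 < ν)
    (hga : ∀ t, 0 ≤ t → g t = a * (1 + t) ^ (-ν)) {w : ℝ → H} (hw : Continuous w)
    (hw0 : w 0 ≠ 0) :
    ∃ c, 0 < c ∧ ∀ t, 0 ≤ t → c * (1 + t) ^ (-ν) ≤ hilbertEnergy g w t := by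
  set b := ‖w 0‖ ^ 2 / 4 with hb
  have hb0 : 0 < b := by have := norm_pos_iff.2 hw0; positivity
  have hl0 := hg.integral_lt
  set l := 1 - ∫ s in Ioi (0 : ℝ), g s with hl
  have hev : ∀ᶠ τ in 𝓝 (0 : ℝ), b < ‖w τ‖ ^ 2 := by
    have hc : Continuous fun τ => ‖w τ‖ ^ 2 := hw.norm.pow 2
    have hlt : b < ‖w 0‖ ^ 2 := by linarith
    exact hc.continuousAt.eventually (lt_mem_nhds hlt)
  obtain ⟨d, hd0, hd⟩ := Metric.eventually_nhds_iff.1 hev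
  have hdb : ∀ τ ∈ Icc 0 (d / 2), b ≤ ‖w τ‖ ^ 2 := fun τ hτ => by
    refine (hd ?_).le
    rw [Real.dist_eq, sub_zero, abs_of_nonneg hτ.1]
    linarith [hτ.2]
  refine ⟨min (l * b / 8) (a * (d / 2) * b / 8), by positivity, fun t ht => ?_⟩
  have hr0 : 0 < (1 + t) ^ (-ν) := Real.rpow_pos_of_pos (by linarith) _
  have hr1 : (1 + t) ^ (-ν) ≤ 1 :=
    Real.rpow_le_one_of_one_le_of_nonpos (by linarith) (by linarith)
  set r := (1 + t) ^ (-ν) with hr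
  have hlow := norm_sq_le_hilbertEnergy (w := w) hg ht
  rcases le_or_gt (b / 4) (‖w t‖ ^ 2) with hx | hx
  · calc min (l * b / 8) (a * (d / 2) * b / 8) * r ≤ l * b / 8 * 1 :=
          mul_le_mul (min_le_left _ _) hr1 hr0.le (by positivity)
      _ ≤ l / 2 * ‖w t‖ ^ 2 := by nlinarith
      _ ≤ _ := hlow
  have htd : d / 2 < t := by
    by_contra! h
    linarith [hdb t ⟨ht, h⟩]
  have hint := memory_intervalIntegrable hg.integrableOn hw ht
  have hmem : a * r * (b / 4) * (d / 2) ≤ memory g w t := by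
    have h1 : ∫ τ in (0 : ℝ)..(d / 2), g (t - τ) * ‖w t - w τ‖ ^ 2 ≤ memory g w t := by
      refine intervalIntegral.integral_mono_interval le_rfl (by linarith) htd.le ?_ hint
      filter_upwards [ae_restrict_mem measurableSet_Ioc] with τ hτ
      exact mul_nonneg (hg.nonneg _ (by linarith [hτ.2])) (sq_nonneg _)
    have h2 : ∫ _τ in (0 : ℝ)..(d / 2), a * r * (b / 4) ≤
        ∫ τ in (0 : ℝ)..(d / 2), g (t - τ) * ‖w t - w τ‖ ^ 2 := by
      refine intervalIntegral.integral_mono_on (by linarith) intervalIntegrable_const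
        (hint.mono_set ?_) fun τ hτ => ?_
      · rw [uIcc_of_le (by linarith), uIcc_of_le ht]
        exact Icc_subset_Icc_right htd.le
      · have h3 : 0 ≤ t - τ := by linarith [hτ.2]
        rw [hga _ h3]
        have h4 : r ≤ (1 + (t - τ)) ^ (-ν) :=
          Real.rpow_le_rpow_of_nonpos (by linarith) (by linarith [hτ.1]) (by linarith)
        have h5 : b / 4 ≤ ‖w t - w τ‖ ^ 2 := by
          have h6 := hdb τ hτ
          have h7 : ‖w τ‖ ≤ ‖w t - w τ‖ + ‖w t‖ := by
            have := norm_sub_le (w t) (w t - w τ)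
            rw [sub_sub_cancel] at this
            linarith
          nlinarith [norm_nonneg (w τ), norm_nonneg (w t), norm_nonneg (w t - w τ),
            sq_nonneg (‖w t - w τ‖ - ‖w t‖)]
        have h8 := mul_le_mul_of_nonneg_left h4 ha.le
        exact mul_le_mul h8 h5 (by positivity) (by positivity)
    rw [intervalIntegral.integral_const, sub_zero, smul_eq_mul] at h2
    linarith
  have hE : 1 / 2 * memory g w t ≤ hilbertEnergy g w t := by
    have h2 := hg.integral_le ht
    have h3 := mul_nonneg (by linarith : 0 ≤ 1 - ∫ s in (0 : ℝ)..t, g s) (sq_nonneg ‖w t‖)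
    unfold hilbertEnergy
    linarith
  calc min (l * b / 8) (a * (d / 2) * b / 8) * r ≤ a * (d / 2) * b / 8 * r :=
        mul_le_mul_of_nonneg_right (min_le_right _ _) hr0.le
    _ ≤ _ := by linarith

theorem decayCondition_of_polynomial (ha : 0 < a) (hν : 2 < ν)
    (hga : ∀ t, 0 ≤ t → g t = a * (1 + t) ^ (-ν)) :
    DecayCondition g (fun _ => ν * a ^ (-1 / ν)) ((ν + 1) / ν) := by
  have hν0 : 0 < ν := by linarith
  refine ⟨?_, ?_, fun t _ => by positivity, fun _ _ _ _ _ => le_rfl,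
    differentiableOn_const _, fun t ht => le_of_eq ?_⟩
  · rw [le_div_iff₀ hν0]; linarith
  · rw [div_lt_iff₀ hν0]; linarith
  · have h1 : 0 < 1 + t := by linarith
    have hd : HasDerivAt (fun s : ℝ => a * (1 + s) ^ (-ν)) (a * (1 * -ν * (1 + t) ^ (-ν - 1))) t :=
      (((hasDerivAt_id t).const_add 1).rpow_const (Or.inl h1.ne')).const_mul a
    rw [derivWithin_congr (s := Ici 0) (fun s hs => hga s hs) (hga t ht),
      hd.hasDerivWithinAt.derivWithin (uniqueDiffOn_Ici 0 t ht), hga t ht,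
      Real.mul_rpow ha.le (by positivity), ← Real.rpow_mul h1.le,
      show -ν * ((ν + 1) / ν) = -ν - 1 by field_simp; ring]
    have e : a ^ (-1 / ν) * a ^ ((ν + 1) / ν) = a := by
      rw [← Real.rpow_add ha, show -1 / ν + (ν + 1) / ν = 1 by field_simp; ring, Real.rpow_one]
    calc a * (1 * -ν * (1 + t) ^ (-ν - 1)) =
        -ν * (a ^ (-1 / ν) * a ^ ((ν + 1) / ν)) * (1 + t) ^ (-ν - 1) := by rw [e]; ring
      _ = _ := by ring

theorem one_add_mul_rpow_le {k ν t : ℝ} (hk : 0 < k) (hν : 0 < ν) (ht : 0 ≤ t) :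
    (1 + k * t) ^ (-ν) ≤ (min 1 k) ^ (-ν) * (1 + t) ^ (-ν) := by
  have hm : 0 < min 1 k := lt_min one_pos hk
  rw [← Real.mul_rpow hm.le (by linarith)]
  refine Real.rpow_le_rpow_of_nonpos (by positivity) ?_ (by linarith)
  nlinarith [min_le_left 1 k, mul_le_mul_of_nonneg_right (min_le_right 1 k) ht]

/-- For constant ξ the rate is a power of 1 + Ct, with exponent -1/(2p-2) < -1 precisely because p <
3/2. -/
theorem integrableRate_const {k p : ℝ} (hk : 0 < k) (hp1 : 1 < p) (hp : p < 3 / 2) :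
    IntegrableRate (fun _ => k) p := by
  unfold IntegrableRate
  have hk' : 0 < k ^ (2 * p - 1) := Real.rpow_pos_of_pos hk _
  have hexp : -1 / (2 * p - 2) < -1 := by
    rw [div_lt_iff₀ (by linarith)]
    linarith
  have hi : IntegrableOn (fun t : ℝ => (t + 1) ^ (-1 / (2 * p - 2))) (Ioi 0) :=
    integrableOn_add_rpow_Ioi_of_lt hexp (by norm_num)
  refine Integrable.mono' (hi.const_mul (min 1 (k ^ (2 * p - 1)) ^ (-1 / (2 * p - 2)))) ?_ ?_
  · refine ContinuousOn.aestronglyMeasurable ?_ measurableSet_Ioi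
    simp only [intervalIntegral.integral_const, sub_zero, smul_eq_mul]
    refine ContinuousOn.rpow_const (by fun_prop) fun t ht => Or.inl ?_
    have : 0 < t := ht
    positivity
  · filter_upwards [ae_restrict_mem measurableSet_Ioi] with t ht
    have ht0 : 0 < t := ht
    simp only [intervalIntegral.integral_const, sub_zero, smul_eq_mul]
    rw [Real.norm_of_nonneg (by positivity)]
    have h := one_add_mul_rpow_le (ν := 1 / (2 * p - 2)) hk'
      (by rw [one_div]; exact inv_pos.2 (by linarith)) ht0.le
    rw [← neg_div] at h
    rw [mul_comm t, add_comm t]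
    exact h

end PolynomialKernel

/-! ### Assembly of the estimates -/

/-- By Sobolev–Poincaré a vanishing gradient forces the function to vanish. This turns u₀ ≠ 0 into
w(0) ≠ 0 for the lower bound. -/
theorem H10.gradient_ne_zero {n : ℕ} (hn : 1 ≤ n) {Ω : Set (Vec n)}
    (hΩb : Bornology.IsBounded Ω) {m : ℝ} (hm : ExponentCondition n m) {w : H10 Ω} (hw : w ≠ 0) :
    H10.gradient w ≠ 0 := by
  intro h
  obtain ⟨S, -, hS⟩ := H10.exists_eLpNorm_fn_le hn hΩb hm
  have h1 := hS w
  rw [h, norm_zero, mul_zero, ENNReal.ofReal_zero, nonpos_iff_eq_zero,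
    eLpNorm_eq_zero_iff (Lp.aestronglyMeasurable _) (by simp; linarith [hm.1])] at h1
  have h2 : H10.fn w = 0 := Lp.ext (h1.trans (Lp.coeFn_zero _ _ _).symm)
  exact hw (Subtype.ext (Prod.ext h2 h))

/-- The decay estimates for all admissible pairs `(ξ, p)` at once. -/
theorem IsWeakSolution.decay {n : ℕ} (hn : 1 ≤ n) {Ω : Set (Vec n)}
    (hΩb : Bornology.IsBounded Ω) {A : ℝ → Matrix (Fin n) (Fin n) ℝ} (hA : IsCoercive A)
    {g ξ : ℝ → ℝ} {p m : ℝ} (hg : IsRelaxation g) (hp : DecayCondition g ξ p)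
    (hm : ExponentCondition n m) {u₀ : H10 Ω} {u : ℝ → H10 Ω} {ut : ℝ → Vec n → Vec n}
    (hu : IsWeakSolution Ω A g m u₀ u ut) :
    (p = 1 → ∃ K c, 0 < K ∧ 0 < c ∧ ∀ t, 0 ≤ t →
      energy g u t ≤ K * Real.exp (-c * ∫ s in (0 : ℝ)..t, ξ s)) ∧
    (1 < p → ∃ K, 0 < K ∧ ∀ t, 0 ≤ t →
      energy g u t ≤ K * (1 + ∫ s in (0 : ℝ)..t, ξ s ^ (2 * p - 1)) ^ (-1 / (2 * p - 2))) ∧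
    (1 < p → IntegrableRate ξ p → ∃ K, 0 < K ∧ ∀ t, 0 ≤ t →
      energy g u t ≤ K * (1 + ∫ s in (0 : ℝ)..t, ξ s ^ p) ^ (-1 / (p - 1))) := by
  have : Fact (1 ≤ ENNReal.ofReal m) :=
    ⟨by rw [ENNReal.one_le_ofReal]; linarith [hm.1]⟩
  obtain ⟨c, hc0, hc⟩ := hA.coercive
  obtain ⟨K, hK⟩ := hA.bounded
  have hdis := hu.isDissipative hm.1 hg hp hc0.le hK hc
  obtain ⟨C₀, hC₀, hstab⟩ := hu.exists_stabilization hn hΩb hm hg hp hc0 hK hdis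
  refine ⟨fun h1 => ?_, fun h1 => ?_, fun h1 h2 => ?_⟩
  · obtain ⟨L, d, hL, hd, h⟩ := hdis.exp_decay hg hp hC₀ hstab h1
    exact ⟨L, d, hL, hd, fun t ht => (energy_eq_hilbertEnergy ht).trans_le (h t ht)⟩
  · obtain ⟨L, hL, h⟩ := hdis.rpow_decay hg hp hC₀ hstab h1
    exact ⟨L, hL, fun t ht => (energy_eq_hilbertEnergy ht).trans_le (h t ht)⟩
  · obtain ⟨L, hL, h⟩ := hdis.rpow_decay_of_integrable hg hp hC₀ hstab h1 h2
    exact ⟨L, hL, fun t ht => (energy_eq_hilbertEnergy ht).trans_le (h t ht)⟩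

end ViscoHeat

theorem theorem3p3 {n : ℕ} (hn : 1 ≤ n)
    (Ω : Set (ViscoHeat.Vec n)) (hΩ : IsOpen Ω) (hΩb : Bornology.IsBounded Ω)
    (A : ℝ → Matrix (Fin n) (Fin n) ℝ) (hA : ViscoHeat.IsCoercive A)
    (g : ℝ → ℝ) (hg : ViscoHeat.IsRelaxation g)
    (ξ : ℝ → ℝ) (p : ℝ) (hp : ViscoHeat.DecayCondition g ξ p)
    (m : ℝ) (hm : ViscoHeat.ExponentCondition n m)
    (u₀ : ViscoHeat.H10 Ω) (u : ℝ → ViscoHeat.H10 Ω)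
    (ut : ℝ → ViscoHeat.Vec n → ViscoHeat.Vec n)
    (hu : ViscoHeat.IsWeakSolution Ω A g m u₀ u ut) :
    -- decay estimates
    (∃ l₀ l₁ : ℝ, 0 < l₀ ∧ 0 < l₁ ∧
      (p = 1 → ∀ t, 0 ≤ t →
        ViscoHeat.energy g u t ≤ l₀ * Real.exp (-l₁ * ∫ s in (0 : ℝ)..t, ξ s)) ∧
      (1 < p → ∀ t, 0 ≤ t →
        ViscoHeat.energy g u t ≤
          l₀ * (1 + ∫ s in (0 : ℝ)..t, ξ s ^ (2 * p - 1)) ^ (-1 / (2 * p - 2))) ∧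
      (1 < p → ViscoHeat.IntegrableRate ξ p → ∀ t, 0 ≤ t →
        ViscoHeat.energy g u t ≤
          l₀ * (1 + ∫ s in (0 : ℝ)..t, ξ s ^ p) ^ (-1 / (p - 1)))) ∧
    -- optimality of the last rate for polynomially decaying relaxation functions
    (∀ a ν : ℝ, 0 < a → 2 < ν → (∀ t, 0 ≤ t → g t = a * (1 + t) ^ (-ν)) →
      ViscoHeat.DecayCondition g (fun _ => ν * a ^ (-1 / ν)) ((ν + 1) / ν) ∧
      ViscoHeat.IntegrableRate (fun _ => ν * a ^ (-1 / ν)) ((ν + 1) / ν) ∧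
      (∃ C : ℝ, 0 < C ∧ ∀ t, 0 ≤ t → ViscoHeat.energy g u t ≤ C * (1 + t) ^ (-ν)) ∧
      (u₀ ≠ 0 → ∃ c : ℝ, 0 < c ∧ ∀ t, 0 ≤ t → c * (1 + t) ^ (-ν) ≤ ViscoHeat.energy g u t)) := by
  obtain ⟨h1, h2, h3⟩ := hu.decay hn hΩb hA hg hp hm
  refine ⟨?_, fun a ν ha hν hga => ?_⟩
  · have hrate0 : ∀ (q e t : ℝ), 0 ≤ t → 0 ≤ (1 + ∫ s in (0 : ℝ)..t, ξ s ^ q) ^ e := by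
      intro q e t ht
      refine Real.rpow_nonneg ?_ _
      have := intervalIntegral.integral_nonneg (μ := volume) ht fun x hx =>
        Real.rpow_nonneg (hp.nonneg x hx.1) q
      linarith
    rcases hp.one_le.eq_or_lt with hp1 | hp1
    · obtain ⟨K, c, hK, hc, h⟩ := h1 hp1.symm
      exact ⟨K, c, hK, hc, fun _ => h, fun h' => absurd h' (by linarith),
        fun h' => absurd h' (by linarith)⟩
    · obtain ⟨K, hK, h⟩ := h2 hp1
      by_cases hr : ViscoHeat.IntegrableRate ξ p
      · obtain ⟨L, hL, h'⟩ := h3 hp1 hr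
        -- One λ₀ must serve both estimates for p > 1; λ₁ is irrelevant there and set to 1.
        refine ⟨max K L, 1, lt_max_of_lt_left hK, one_pos, fun h' => absurd h' (by linarith),
          fun _ t ht => ?_, fun _ _ t ht => ?_⟩
        · exact (h t ht).trans (mul_le_mul_of_nonneg_right (le_max_left _ _) (hrate0 _ _ t ht))
        · exact (h' t ht).trans (mul_le_mul_of_nonneg_right (le_max_right _ _) (hrate0 _ _ t ht))
      · exact ⟨K, 1, hK, one_pos, fun h' => absurd h' (by linarith), fun _ => h,
          fun _ h' => absurd h' hr⟩
  · have hν0 : 0 < ν := by linarith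
    have hk : 0 < ν * a ^ (-1 / ν) := mul_pos hν0 (Real.rpow_pos_of_pos ha _)
    have hdc := ViscoHeat.decayCondition_of_polynomial ha hν hga
    have hp1 : 1 < (ν + 1) / ν := by rw [lt_div_iff₀ hν0]; linarith
    have hir := ViscoHeat.integrableRate_const hk hp1 hdc.lt
    refine ⟨hdc, hir, ?_, fun hu0 => ?_⟩
    -- The decay estimate is applied to the pair dictated by the kernel, which may differ from the
    -- given ξ and p.
    · obtain ⟨K, hK, h⟩ := (hu.decay hn hΩb hA hg hdc hm).2.2 hp1 hir
      set k := (ν * a ^ (-1 / ν)) ^ ((ν + 1) / ν) with hkdef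
      have hk0 : 0 < k := Real.rpow_pos_of_pos hk _
      refine ⟨K * (min 1 k) ^ (-ν), mul_pos hK (Real.rpow_pos_of_pos (lt_min one_pos hk0) _),
        fun t ht => (h t ht).trans ?_⟩
      rw [show -1 / ((ν + 1) / ν - 1) = -ν by field_simp; ring, mul_assoc,
        intervalIntegral.integral_const, sub_zero, smul_eq_mul, mul_comm t]
      exact mul_le_mul_of_nonneg_left (ViscoHeat.one_add_mul_rpow_le hk0 hν0 ht) hK.le
    · have hw := ViscoHeat.continuous_gradTraj hu.continuousOn
      have hw0 : ViscoHeat.gradTraj u 0 ≠ 0 := by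
        rw [ViscoHeat.gradTraj_of_nonneg le_rfl, hu.initial]
        exact ViscoHeat.H10.gradient_ne_zero hn hΩb hm hu0
      obtain ⟨c, hc, h⟩ :=
        ViscoHeat.exists_le_hilbertEnergy_of_polynomial hg ha hν0 hga hw hw0
      exact ⟨c, hc, fun t ht => (h t ht).trans_eq (ViscoHeat.energy_eq_hilbertEnergy ht).symm⟩
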